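/- **Conventions.** For an interval $I=[a,b]$, the size-$k$ range equipartition $R_{I,k}$ consists of the $k$ consecutive intervals of length $(b-a)/k$ that make up $I$, each closed on the left and open on the right, except the last, which is closed. $\mathcal P(I,k,[j])$ is the set of partitions of $I$ into $k$ nonempty intervals, each of which is a union of adjacent parts of $R_{I,j}$ (it is empty if $j<k$). A $k\times\ell$ grid $G=(P,Q)$ consists of $k$ intervals $P_1,\dots,P_k$ on the $y$-axis and $\ell$ intervals $Q_1,\dots,Q_\ell$ on the $x$-axis; $\mathcal G(k,\ell)$ is the set of those in which $P$ and $Q$ partition the whole real line into nonempty intervals. For a rectangle $L=L_x\times L_y=[x_0,x_1]\times[y_0,y_1]$, $c>0$ and $k,\ell\ge 2$, $\mathcal R(L,c,k,\ell)$ is the set of grids $(P,Q)$ with $Q=R_{L_x,\ell}$ and $P\in\mathcal P(L_y,k,[\lfloor c\ell\rfloor])$ if $k\le\ell$, and with $P=R_{L_y,k}$ and $Q\in\mathcal P(L_x,\ell,[\lfloor ck\rfloor])$ if $k>\ell$. For a probability distribution $\Pi=(X,Y)$ on $\mathbb R^2$ and a grid $G$ put $p(i,j)=\Pr(X\in Q_j,\,Y\in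 P_i)$; for a dataset $D$ of $n$ points, let $p(i,j)$ be the fraction of the points with $x$-coordinate in $Q_j$ and $y$-coordinate in $P_i$. With $p(i,*)$ and $p(*,j)$ the row and column sums, and $0\log 0=0$, let $$I^\star(\,\cdot\,|_G)=\frac{1}{\log_2\min\{k,\ell\}}\sum_{i,j}p(i,j)\log_2\frac{p(i,j)}{p(i,*)\,p(*,j)} .$$ Define $$\mathrm{MIC}^*(\Pi)=\sup_{k,\ell\ge2}\ \sup_{G\in\mathcal G(k,\ell)} I^\star(\Pi|_G),\qquad \mathrm{MICr}(D,L,B,c)=\max_{k,\ell\ge 2:\ k\ell\le B}\ \max_{G\in\mathcal R(L,c,k,\ell)} I^\star(D|_G),$$ where a maximum over the empty set is $0$. **Theorem.** Let $\Pi=(X,Y)$ be a joint distribution on $\mathbb R^2$ with $\Pr((X,Y)\in L)=1$ for some $L=[x_0,x_1]\times[y_0,y_1]$, and for each $n$ let $D_n$ be a dataset of $n$ points sampled i.i.d. from $\Pi$. For every finite $c>0$, every $\alpha\in(0,0.5)$ and every $B:\mathbb N\to\mathbb R$ with $B(n)\to\infty$ and $B(n)=O(n^\alpha)$, $$\mathrm{MICr}(D_n,L,B(n),c)\longrightarrow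 \mathrm{MIC}^*(\Pi)\quad\text{in probability as } n\to\infty .$$ -/

import Mathlib

open MeasureTheory ProbabilityTheory Filter

noncomputable section

namespace MIC

/-- `P` is a partition of `S ⊆ ℝ` into `k` nonempty intervals, listed from left to right. -/
def IsIntervalPartition (S : Set ℝ) {k : ℕ} (P : Fin k → Set ℝ) : Prop :=
  (∀ i, (P i).Nonempty ∧ (P i).OrdConnected) ∧
  (∀ i j, i < j → ∀ s ∈ P i, ∀ t ∈ P j, s < t) ∧
  (⋃ i, P i) = S

/-- The size-`k` range equipartition of `[a, b]`: intervals of length `(b - a) / k`, all of them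
closed on the left and open on the right, except the last one, which is closed. -/
def rangeEquipartition (a b : ℝ) (k : ℕ) (i : Fin k) : Set ℝ :=
  if (i : ℕ) + 1 = k then Set.Icc (a + (i : ℝ) * ((b - a) / k)) b
  else Set.Ico (a + (i : ℝ) * ((b - a) / k)) (a + ((i : ℝ) + 1) * ((b - a) / k))

/-- Every part of `P` is a union of adjacent parts of `C`. -/
def IsSubpartition {k j : ℕ} (P : Fin k → Set ℝ) (C : Fin j → Set ℝ) : Prop :=
  ∀ i, ∃ s : Set (Fin j), s.OrdConnected ∧ P i = ⋃ m ∈ s, C m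

/-- All size-`k` subpartitions of the size-`j` range equipartition of `[a, b]`
(there are none if `j < k`). -/
def rangeSubpartitions (a b : ℝ) (k j : ℕ) : Set (Fin k → Set ℝ) :=
  {P | IsIntervalPartition (Set.Icc a b) P ∧ IsSubpartition P (rangeEquipartition a b j)}

/-- A `k × ℓ` grid: `rows` divides the `y`-axis (or a part of it), `cols` the `x`-axis. -/
structure Grid (k ℓ : ℕ) where
  rows : Fin k → Set ℝ
  cols : Fin ℓ → Set ℝ

/-- The set of all `k × ℓ` grids on `ℝ²`. -/
def allGrids (k ℓ : ℕ) : Set (Grid k ℓ) :=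
  {G | IsIntervalPartition Set.univ G.rows ∧ IsIntervalPartition Set.univ G.cols}

/-- The grids on `[x₀, x₁] × [y₀, y₁]` over which the `(k, ℓ)` entry of the range
equicharacteristic matrix is maximized: the axis with more parts carries the range equipartition,
the other one a subpartition of a range equipartition that is `c` times as fine. -/
def rangeGrids (x₀ x₁ y₀ y₁ c : ℝ) (k ℓ : ℕ) : Set (Grid k ℓ) :=
  {G | if k ≤ ℓ then
      G.cols = rangeEquipartition x₀ x₁ ℓ ∧ G.rows ∈ rangeSubpartitions y₀ y₁ k ⌊c * ℓ⌋₊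
    else
      G.rows = rangeEquipartition y₀ y₁ k ∧ G.cols ∈ rangeSubpartitions x₀ x₁ ℓ ⌊c * k⌋₊}

/-- The cell in row `i` and column `j`. -/
def Grid.cell {k ℓ : ℕ} (G : Grid k ℓ) (i : Fin k) (j : Fin ℓ) : Set (ℝ × ℝ) :=
  {p | p.1 ∈ G.cols j ∧ p.2 ∈ G.rows i}

/-- Mutual information, in bits, of a joint probability mass function `p`
(with `0 log 0 = 0`). -/
def mutualInfo {k ℓ : ℕ} (p : Fin k → Fin ℓ → ℝ) : ℝ :=
  ∑ i, ∑ j, p i j * Real.logb 2 (p i j / ((∑ j', p i j') * ∑ i', p i' j))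

/-- Mutual information normalized by `log₂ (min k ℓ)`. -/
def normMutualInfo {k ℓ : ℕ} (p : Fin k → Fin ℓ → ℝ) : ℝ :=
  mutualInfo p / Real.logb 2 (min k ℓ : ℕ)

/-- The cell frequencies of a dataset of `n` points. -/
def empiricalPMF {n k ℓ : ℕ} (D : Fin n → ℝ × ℝ) (G : Grid k ℓ) (i : Fin k) (j : Fin ℓ) : ℝ :=
  ({m : Fin n | D m ∈ G.cell i j}.ncard : ℝ) / n

/-- The cell probabilities of a joint distribution. -/
def gridPMF {k ℓ : ℕ} (law : Measure (ℝ × ℝ)) (G : Grid k ℓ) (i : Fin k) (j : Fin ℓ) : ℝ :=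
  law.real (G.cell i j)

/-- The `(k, ℓ)` entry of the characteristic matrix of a joint distribution. -/
def charEntry (law : Measure (ℝ × ℝ)) (k ℓ : ℕ) : ℝ :=
  sSup ((fun G : Grid k ℓ => normMutualInfo (gridPMF law G)) '' allGrids k ℓ)

/-- `MIC*`: the supremum of the characteristic matrix. -/
def micStar (law : Measure (ℝ × ℝ)) : ℝ :=
  sSup {v | ∃ k ℓ : ℕ, 2 ≤ k ∧ 2 ≤ ℓ ∧ v = charEntry law k ℓ}

/-- The `(k, ℓ)` entry of the range equicharacteristic matrix of a dataset: a maximum over a finite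
set of grids, and `0` if there is no such grid. -/
def rangeEntry {n : ℕ} (D : Fin n → ℝ × ℝ) (x₀ x₁ y₀ y₁ c : ℝ) (k ℓ : ℕ) : ℝ :=
  sSup ((fun G : Grid k ℓ => normMutualInfo (empiricalPMF D G)) '' rangeGrids x₀ x₁ y₀ y₁ c k ℓ)

/-- The `MICr` statistic with range `[x₀, x₁] × [y₀, y₁]`, maximum grid size `B` and
parameter `c`. -/
def micr {n : ℕ} (D : Fin n → ℝ × ℝ) (x₀ x₁ y₀ y₁ B c : ℝ) : ℝ :=
  sSup {v | ∃ k ℓ : ℕ, 2 ≤ k ∧ 2 ≤ ℓ ∧ (k : ℝ) * ℓ ≤ B ∧ v = rangeEntry D x₀ x₁ y₀ y₁ c k ℓ}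

end MIC

end

namespace MIC

/-! ### Mutual information of finite joint mass functions -/

/-! The statistic is compared with the population values of range grids. Such a grid never beats
MIC*, because its two partitions extend to the whole line (`normMutualInfo_rangeGrids_le_micStar`;
on a degenerate axis the mutual information may be zero instead). Conversely, range grids come
arbitrarily close to a positive MIC* (`exists_rangeGrid_near_micStar`): on the axis with fewer
parts, approximate the cut points; on the other, pass to a very fine equipartition. Refining cannot
lower mutual information (`mutualInfo_merge_le`), and the normalizer depends only on the smaller
number of parts, so it does not grow.

What remains is a deviation bound uniform over all range grids with kℓ ≤ B(n). All unions of their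
cells lie in one finite family of 2^O(B²) sets. Hoeffding's inequality and a union bound keep every
deviation below n^(-γ), because B² = O(n^(2α)) is of smaller order than n · n^(-2γ) = n^(1/2+α);
this is where α < 1/2 enters. Controlling unions of cells controls the ℓ¹ distance of the mass
functions (`sum_abs_le_two_mul`), and the modulus of continuity `abs_mutualInfo_sub_le` turns this
into an error of order n^(-γ) log n + B/n. -/

lemma mutualInfo_comm {k ℓ : ℕ} (p : Fin k → Fin ℓ → ℝ) :
    mutualInfo (fun j i => p i j) = mutualInfo p := by
  unfold mutualInfo
  rw [Finset.sum_comm]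
  refine Finset.sum_congr rfl fun i _ => Finset.sum_congr rfl fun j _ => ?_
  rw [mul_comm (∑ i', p i' j)]

lemma normMutualInfo_comm {k ℓ : ℕ} (p : Fin k → Fin ℓ → ℝ) :
    normMutualInfo (fun j i => p i j) = normMutualInfo p := by
  unfold normMutualInfo
  rw [mutualInfo_comm, min_comm]

lemma le_row_sum {k ℓ : ℕ} {p : Fin k → Fin ℓ → ℝ} (hp : ∀ i j, 0 ≤ p i j) (i : Fin k)
    (j : Fin ℓ) : p i j ≤ ∑ j', p i j' :=
  Finset.single_le_sum (f := fun j' => p i j') (fun j' _ => hp i j') (Finset.mem_univ j)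

lemma le_col_sum {k ℓ : ℕ} {p : Fin k → Fin ℓ → ℝ} (hp : ∀ i j, 0 ≤ p i j) (i : Fin k)
    (j : Fin ℓ) : p i j ≤ ∑ i', p i' j :=
  Finset.single_le_sum (f := fun i' => p i' j) (fun i' _ => hp i' j) (Finset.mem_univ i)

/-- Mutual information as joint entropy subtracted from the marginal entropies. -/
lemma mutualInfo_eq_entropy {k ℓ : ℕ} {p : Fin k → Fin ℓ → ℝ} (hp : ∀ i j, 0 ≤ p i j) :
    mutualInfo p = ((∑ i, Real.negMulLog (∑ j, p i j)) + (∑ j, Real.negMulLog (∑ i, p i j))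
      - ∑ i, ∑ j, Real.negMulLog (p i j)) / Real.log 2 := by
  have key : ∀ i j, p i j * Real.logb 2 (p i j / ((∑ j', p i j') * ∑ i', p i' j)) =
      (-(p i j * Real.log (∑ j', p i j')) - p i j * Real.log (∑ i', p i' j)
        - Real.negMulLog (p i j)) / Real.log 2 := by
    intro i j
    rcases (hp i j).eq_or_lt with h | h
    · simp [← h]
    · have hr := h.trans_le (le_row_sum hp i j)
      have hc := h.trans_le (le_col_sum hp i j)
      rw [Real.logb, Real.log_div h.ne' (mul_pos hr hc).ne', Real.log_mul hr.ne' hc.ne',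
        Real.negMulLog]
      ring
  unfold mutualInfo
  simp_rw [key, ← Finset.sum_div, Finset.sum_sub_distrib]
  congr 3
  · simp_rw [Finset.sum_neg_distrib, ← Finset.sum_mul, Real.negMulLog, neg_mul,
      Finset.sum_neg_distrib]
    rw [sub_eq_add_neg]
    congr 2
    rw [Finset.sum_comm]
    simp_rw [← Finset.sum_mul]

/-- The entropy form is what makes this work when cells lose all their mass: `negMulLog` is
continuous at 0, while the quotient inside the logarithm is not. -/
lemma tendsto_mutualInfo {ι : Type*} {u : Filter ι} {k ℓ : ℕ} {p : ι → Fin k → Fin ℓ → ℝ}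
    {q : Fin k → Fin ℓ → ℝ} (hp : ∀ x i j, 0 ≤ p x i j) (hq : ∀ i j, 0 ≤ q i j)
    (h : ∀ i j, Tendsto (fun x => p x i j) u (nhds (q i j))) :
    Tendsto (fun x => mutualInfo (p x)) u (nhds (mutualInfo q)) := by
  have hL := Real.continuous_negMulLog
  simp_rw [mutualInfo_eq_entropy (hp _), mutualInfo_eq_entropy hq]
  refine Tendsto.div_const (Tendsto.sub (Tendsto.add ?_ ?_) ?_) _
  · exact tendsto_finsetSum _ fun i _ => (hL.tendsto _).comp (tendsto_finsetSum _ fun j _ => h i j)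
  · exact tendsto_finsetSum _ fun j _ => (hL.tendsto _).comp (tendsto_finsetSum _ fun i _ => h i j)
  · exact tendsto_finsetSum _ fun i _ => tendsto_finsetSum _ fun j _ => (hL.tendsto _).comp (h i j)

/-- The pointwise inequality behind Gibbs' inequality. -/
lemma sub_le_mul_log_div {a b : ℝ} (ha : 0 ≤ a) (hb : 0 ≤ b) (hab : b = 0 → a = 0) :
    a - b ≤ a * Real.log (a / b) := by
  rcases ha.eq_or_lt with h | h
  · simp [← h, hb]
  · have hb' : 0 < b := hb.lt_of_ne' fun h0 => h.ne' (hab h0)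
    have := Real.one_sub_inv_le_log_of_pos (div_pos h hb')
    have h2 := mul_le_mul_of_nonneg_left this ha
    rw [inv_div, mul_sub, mul_one, mul_div_cancel₀ _ h.ne'] at h2
    exact h2

lemma mutualInfo_eq_log {k ℓ : ℕ} (p : Fin k → Fin ℓ → ℝ) :
    mutualInfo p = (∑ i, ∑ j, p i j * Real.log (p i j / ((∑ j', p i j') * ∑ i', p i' j)))
      / Real.log 2 := by
  unfold mutualInfo
  simp_rw [Real.logb, mul_div_assoc', Finset.sum_div]

/-- Gibbs' inequality against the product of the marginals. For total mass s ≤ 1 the lower bound is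
s - s² ≥ 0, so a subprobability suffices. -/
lemma mutualInfo_nonneg {k ℓ : ℕ} {p : Fin k → Fin ℓ → ℝ} (hp : ∀ i j, 0 ≤ p i j)
    (h1 : ∑ i, ∑ j, p i j ≤ 1) : 0 ≤ mutualInfo p := by
  rw [mutualInfo_eq_log]
  refine div_nonneg ?_ (Real.log_nonneg one_le_two)
  have hs : 0 ≤ ∑ i, ∑ j, p i j := Finset.sum_nonneg fun i _ => Finset.sum_nonneg fun j _ => hp i j
  calc 0 ≤ (∑ i, ∑ j, p i j) - (∑ i, ∑ j, p i j) * (∑ j, ∑ i, p i j) := by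
        rw [Finset.sum_comm (s := (Finset.univ : Finset (Fin ℓ)))]
        nlinarith
    _ = ∑ i, ∑ j, (p i j - (∑ j', p i j') * ∑ i', p i' j) := by
        rw [Finset.sum_mul_sum]
        simp_rw [Finset.sum_sub_distrib]
    _ ≤ _ := by
        refine Finset.sum_le_sum fun i _ => Finset.sum_le_sum fun j _ => ?_
        have hr := le_row_sum hp i j
        have hc := le_col_sum hp i j
        refine sub_le_mul_log_div (hp i j) (mul_nonneg ((hp i j).trans hr) ((hp i j).trans hc)) ?_
        intro h
        rcases mul_eq_zero.1 h with h | h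
        · exact le_antisymm (hr.trans h.le) (hp i j)
        · exact le_antisymm (hc.trans h.le) (hp i j)

/-- A cell has at most the mass of its column, so mutual information is at most the row entropy;
comparison with the uniform distribution bounds the latter by log k. -/
lemma mutualInfo_le_logb_rows {k ℓ : ℕ} {p : Fin k → Fin ℓ → ℝ} (hp : ∀ i j, 0 ≤ p i j)
    (h1 : ∑ i, ∑ j, p i j = 1) : mutualInfo p ≤ Real.logb 2 k := by
  have hk : (0 : ℝ) < k := by
    rcases Nat.eq_zero_or_pos k with rfl | h
    · simp at h1
    · exact_mod_cast h
  rw [mutualInfo_eq_log, Real.logb]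
  refine div_le_div_of_nonneg_right ?_ (Real.log_nonneg one_le_two)
  -- The slack 1/k - p(i,*) comes from log t ≤ t - 1 and sums to zero over the rows.
  have hterm : ∀ i, ∑ j, p i j * Real.log (p i j / ((∑ j', p i j') * ∑ i', p i' j)) ≤
      (∑ j, p i j) * Real.log k + (1 / k - ∑ j, p i j) := by
    intro i
    rcases (Finset.sum_nonneg fun j (_ : j ∈ Finset.univ) => hp i j).eq_or_lt with h | h
    · have h0 : ∀ j, p i j = 0 := fun j =>
        le_antisymm ((le_row_sum hp i j).trans h.symm.le) (hp i j)
      simp [h0]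
    · have hle : ∑ j, p i j * Real.log (p i j / ((∑ j', p i j') * ∑ i', p i' j)) ≤
          ∑ j, p i j * Real.log (1 / ∑ j', p i j') := by
        refine Finset.sum_le_sum fun j _ => ?_
        rcases (hp i j).eq_or_lt with h' | h'
        · simp [← h']
        · have hc := le_col_sum hp i j
          refine mul_le_mul_of_nonneg_left (Real.log_le_log ?_ ?_) h'.le
          · exact div_pos h' (mul_pos h (h'.trans_le hc))
          · rw [div_le_div_iff₀ (mul_pos h (h'.trans_le hc)) h]
            nlinarith
      refine hle.trans ?_
      rw [← Finset.sum_mul]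
      have h2 := Real.log_le_sub_one_of_pos (div_pos (div_pos one_pos hk) h)
      have h3 := mul_le_mul_of_nonneg_left h2 h.le
      have h4 : Real.log (1 / k / ∑ j, p i j) = Real.log (1 / ∑ j, p i j) - Real.log k := by
        rw [Real.log_div (by positivity) h.ne', one_div, Real.log_inv, one_div, Real.log_inv]
        ring
      rw [h4, mul_sub, mul_sub, mul_div_cancel₀ _ h.ne'] at h3
      linarith
  refine (Finset.sum_le_sum fun i _ => hterm i).trans ?_
  rw [Finset.sum_add_distrib, Finset.sum_sub_distrib, ← Finset.sum_mul, h1]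
  simp [hk.ne']

lemma mutualInfo_le_logb_min {k ℓ : ℕ} {p : Fin k → Fin ℓ → ℝ} (hp : ∀ i j, 0 ≤ p i j)
    (h1 : ∑ i, ∑ j, p i j = 1) : mutualInfo p ≤ Real.logb 2 (min k ℓ : ℕ) := by
  rcases le_total k ℓ with h | h
  · rw [min_eq_left h]
    exact mutualInfo_le_logb_rows hp h1
  · rw [min_eq_right h, ← mutualInfo_comm]
    exact mutualInfo_le_logb_rows (fun j i => hp i j) (by rw [Finset.sum_comm]; exact h1)

lemma one_le_logb_min {k ℓ : ℕ} (hk : 2 ≤ k) (hℓ : 2 ≤ ℓ) :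
    1 ≤ Real.logb 2 (min k ℓ : ℕ) := by
  have h : (2 : ℝ) ≤ (min k ℓ : ℕ) := by exact_mod_cast le_min hk hℓ
  rw [← Real.logb_self_eq_one one_lt_two]
  exact Real.logb_le_logb_of_le one_lt_two two_pos h

lemma normMutualInfo_le_one {k ℓ : ℕ} (hk : 2 ≤ k) (hℓ : 2 ≤ ℓ) {p : Fin k → Fin ℓ → ℝ}
    (hp : ∀ i j, 0 ≤ p i j) (h1 : ∑ i, ∑ j, p i j = 1) : normMutualInfo p ≤ 1 :=
  (div_le_one (one_pos.trans_le (one_le_logb_min hk hℓ))).2 (mutualInfo_le_logb_min hp h1)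

lemma normMutualInfo_nonneg {k ℓ : ℕ} (hk : 2 ≤ k) (hℓ : 2 ≤ ℓ) {p : Fin k → Fin ℓ → ℝ}
    (hp : ∀ i j, 0 ≤ p i j) (h1 : ∑ i, ∑ j, p i j ≤ 1) : 0 ≤ normMutualInfo p :=
  div_nonneg (mutualInfo_nonneg hp h1) (zero_le_one.trans (one_le_logb_min hk hℓ))

/-- Merging columns does not increase mutual information. -/
lemma mutualInfo_merge_le {k ℓ m : ℕ} {p : Fin k → Fin m → ℝ} (hp : ∀ i j, 0 ≤ p i j)
    (g : Fin m → Fin ℓ) :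
    mutualInfo (fun i b => ∑ j with g j = b, p i j) ≤ mutualInfo p := by
  set q : Fin k → Fin ℓ → ℝ := fun i b => ∑ j with g j = b, p i j with hqdef
  have hq : ∀ i b, 0 ≤ q i b := fun i b => Finset.sum_nonneg fun j _ => hp i j
  have hpq : ∀ i j, p i j ≤ q i (g j) := fun i j =>
    Finset.single_le_sum (f := fun j' => p i j') (fun j' _ => hp i j') (by simp)
  have hrow : ∀ i, ∑ b, q i b = ∑ j, p i j := fun i =>
    Finset.sum_fiberwise (Finset.univ) g (fun j => p i j)
  have hcol : ∀ b, ∑ i, q i b = ∑ j with g j = b, ∑ i, p i j := fun b => Finset.sum_comm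
  rw [mutualInfo_eq_log, mutualInfo_eq_log]
  refine div_le_div_of_nonneg_right ?_ (Real.log_nonneg one_le_two)
  have hL : ∑ i, ∑ b, q i b * Real.log (q i b / ((∑ b', q i b') * ∑ i', q i' b)) =
      ∑ i, ∑ j, p i j * Real.log (q i (g j) / ((∑ b', q i b') * ∑ i', q i' (g j))) := by
    refine Finset.sum_congr rfl fun i _ => ?_
    rw [← Finset.sum_fiberwise Finset.univ g]
    refine Finset.sum_congr rfl fun b _ => ?_
    conv_lhs => rw [hqdef]
    dsimp only
    rw [Finset.sum_mul]
    refine Finset.sum_congr rfl fun j hj => ?_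
    rw [(Finset.mem_filter.1 hj).2]
  rw [hL, ← sub_nonneg, ← Finset.sum_sub_distrib]
  simp_rw [← Finset.sum_sub_distrib]
  -- Gibbs' inequality against the mass function that keeps the fine column marginals but
  -- distributes each column over the rows as its merged column does.
  have hterm : ∀ i j, p i j - (∑ i', p i' j) * q i (g j) / (∑ i', q i' (g j)) ≤
      p i j * Real.log (p i j / ((∑ j', p i j') * ∑ i', p i' j)) -
      p i j * Real.log (q i (g j) / ((∑ b', q i b') * ∑ i', q i' (g j))) := by
    intro i j
    have hc := le_col_sum hp i j
    have hqc := le_col_sum hq i (g j)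
    have hr := le_row_sum hp i j
    rcases (hp i j).eq_or_lt with h | h
    · rw [← h]
      have : 0 ≤ (∑ i', p i' j) * q i (g j) / (∑ i', q i' (g j)) :=
        div_nonneg (mul_nonneg ((hp i j).trans hc) (hq i _)) ((hq i _).trans hqc)
      simpa using this
    · have h1 : 0 < q i (g j) := h.trans_le (hpq i j)
      have h2 := h.trans_le hc
      have h3 := h.trans_le hr
      have h4 := h1.trans_le hqc
      refine (sub_le_mul_log_div h.le (by positivity) fun h0 => ?_).trans_eq ?_
      · exact absurd h0 (by positivity)
      · rw [← mul_sub, hrow, ← Real.log_div (by positivity) (by positivity)]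
        congr 2
        field_simp
  refine le_trans ?_ (Finset.sum_le_sum fun i _ => Finset.sum_le_sum fun j _ => hterm i j)
  simp_rw [Finset.sum_sub_distrib]
  rw [sub_nonneg, Finset.sum_comm, Finset.sum_comm (γ := Fin k) (f := fun i j => p i j)]
  refine Finset.sum_le_sum fun j _ => ?_
  rw [← Finset.sum_div, ← Finset.mul_sum]
  have h0 : 0 ≤ ∑ i', p i' j := Finset.sum_nonneg fun i _ => hp i j
  -- A merged column without mass gives the quotient 0 instead of 1, hence only an inequality.
  rw [mul_div_assoc]
  exact mul_le_of_le_one_right h0 (div_self_le_one _)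

/-- Rows that carry no mass can be dropped. -/
lemma mutualInfo_comp_injective {k k' ℓ : ℕ} {p : Fin k → Fin ℓ → ℝ} {e : Fin k' → Fin k}
    (he : Function.Injective e) (h0 : ∀ i, i ∉ Set.range e → ∀ j, p i j = 0) :
    mutualInfo (fun i j => p (e i) j) = mutualInfo p := by
  have hsum : ∀ j, ∑ i, p (e i) j = ∑ i, p i j := fun j =>
    Fintype.sum_of_injective e he _ _ (fun i hi => h0 i hi j) fun _ => rfl
  unfold mutualInfo
  simp_rw [hsum]
  exact Fintype.sum_of_injective e he _ _ (fun i hi => by simp [h0 i hi]) fun _ => rfl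

lemma mutualInfo_eq_zero_of_col {k ℓ : ℕ} {p : Fin k → Fin ℓ → ℝ} (h1 : ∑ i, ∑ j, p i j = 1)
    (b : Fin ℓ) (h0 : ∀ i j, j ≠ b → p i j = 0) : mutualInfo p = 0 := by
  have hrow : ∀ i, ∑ j, p i j = p i b := fun i =>
    Finset.sum_eq_single b (fun j _ hj => h0 i j hj) (by simp)
  have hcol : ∑ i, p i b = 1 := by
    rw [← h1]
    exact Finset.sum_congr rfl fun i _ => (hrow i).symm
  unfold mutualInfo
  refine Finset.sum_eq_zero fun i _ => Finset.sum_eq_zero fun j _ => ?_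
  by_cases hj : j = b
  · subst hj
    rw [hrow, hcol, mul_one]
    by_cases hi : p i j = 0
    · simp [hi]
    · simp [div_self hi]
  · simp [h0 i j hj]

/-! ### Modulus of continuity -/

/-- Writing η for `negMulLog`: η decreases with slope at most 1 on [0, 1], it increases by at most
η(y - x), and Gibbs' pointwise inequality with 1/N bounds η(d) by d log N + 1/N. The free parameter
N makes the modulus linear in d at the cost of 1/N. -/
lemma abs_negMulLog_sub_le_aux {x y N : ℝ} (hx : 0 ≤ x) (hxy : x ≤ y) (hy : y ≤ 1) (hN : 1 ≤ N) :
    |Real.negMulLog x - Real.negMulLog y| ≤ (y - x) * (1 + Real.log N) + 1 / N := by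
  have hN0 : 0 < N := one_pos.trans_le hN
  have hlogN := Real.log_nonneg hN
  rcases hxy.eq_or_lt with rfl | hlt
  · simp [hN0.le]
  have hy0 : 0 < y := hx.trans_lt hlt
  have hd : 0 < y - x := sub_pos.2 hlt
  have hlogy : Real.log y ≤ 0 := Real.log_nonpos hy0.le hy
  have hup : Real.negMulLog x - Real.negMulLog y ≤ y - x := by
    rcases hx.eq_or_lt with rfl | hx0
    · simp only [Real.negMulLog]
      nlinarith
    · have h := Real.log_le_sub_one_of_pos (div_pos hy0 hx0)
      rw [Real.log_div hy0.ne' hx0.ne'] at h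
      have h2 := mul_le_mul_of_nonneg_left h hx
      rw [mul_sub, mul_sub, mul_div_cancel₀ _ hx0.ne'] at h2
      simp only [Real.negMulLog]
      nlinarith
  have hdown : Real.negMulLog y - Real.negMulLog x ≤ Real.negMulLog (y - x) := by
    have h2 : (y - x) * Real.log (y - x) ≤ (y - x) * Real.log y :=
      mul_le_mul_of_nonneg_left (Real.log_le_log hd (by linarith)) hd.le
    have h3 : x * Real.log x ≤ x * Real.log y := by
      rcases hx.eq_or_lt with rfl | hx0
      · simp
      · exact mul_le_mul_of_nonneg_left (Real.log_le_log hx0 hlt.le) hx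
    simp only [Real.negMulLog]
    nlinarith
  have hbd : Real.negMulLog (y - x) ≤ (y - x) * Real.log N + 1 / N := by
    have h := sub_le_mul_log_div hd.le (one_div_pos.2 hN0).le (fun h => absurd h (by positivity))
    rw [div_div_eq_mul_div, div_one, Real.log_mul hd.ne' hN0.ne'] at h
    simp only [Real.negMulLog]
    nlinarith
  have : 0 ≤ (y - x) * Real.log N := mul_nonneg hd.le hlogN
  have : 0 ≤ 1 / N := by positivity
  rw [abs_le]
  constructor <;> nlinarith

lemma abs_negMulLog_sub_le {x y N : ℝ} (hx : x ∈ Set.Icc 0 1) (hy : y ∈ Set.Icc 0 1)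
    (hN : 1 ≤ N) :
    |Real.negMulLog x - Real.negMulLog y| ≤ |x - y| * (1 + Real.log N) + 1 / N := by
  rcases le_total x y with h | h
  · rw [abs_sub_comm x y, abs_of_nonneg (sub_nonneg.2 h)]
    exact abs_negMulLog_sub_le_aux hx.1 h hy.2 hN
  · rw [abs_of_nonneg (sub_nonneg.2 h), abs_sub_comm]
    exact abs_negMulLog_sub_le_aux hy.1 h hx.2 hN

lemma abs_sum_negMulLog_sub_le {ι : Type*} [Fintype ι] {f g : ι → ℝ} {N T : ℝ}
    (hf : ∀ i, f i ∈ Set.Icc 0 1) (hg : ∀ i, g i ∈ Set.Icc 0 1) (hN : 1 ≤ N)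
    (hT : ∑ i, |f i - g i| ≤ T) :
    |∑ i, Real.negMulLog (f i) - ∑ i, Real.negMulLog (g i)| ≤
      T * (1 + Real.log N) + Fintype.card ι / N := by
  rw [← Finset.sum_sub_distrib]
  refine (Finset.abs_sum_le_sum_abs _ _).trans ?_
  refine (Finset.sum_le_sum fun i _ => abs_negMulLog_sub_le (hf i) (hg i) hN).trans ?_
  rw [Finset.sum_add_distrib, ← Finset.sum_mul]
  have := Real.log_nonneg hN
  refine add_le_add (mul_le_mul_of_nonneg_right hT (by linarith)) (le_of_eq ?_)
  simp [div_eq_mul_inv]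

/-- Marginals are no farther apart in ℓ¹ than the joint mass functions, so each of the three
entropies contributes T; the numbers of their terms are k, ℓ and kℓ. -/
lemma abs_mutualInfo_sub_le {k ℓ : ℕ} {p q : Fin k → Fin ℓ → ℝ} (hp : ∀ i j, 0 ≤ p i j)
    (hq : ∀ i j, 0 ≤ q i j) (hp1 : ∑ i, ∑ j, p i j ≤ 1) (hq1 : ∑ i, ∑ j, q i j ≤ 1) {N T : ℝ}
    (hN : 1 ≤ N) (hT : ∑ i, ∑ j, |p i j - q i j| ≤ T) :
    |mutualInfo p - mutualInfo q| ≤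
      (3 * T * (1 + Real.log N) + (k + ℓ + k * ℓ) / N) / Real.log 2 := by
  have hrow : ∀ r : Fin k → Fin ℓ → ℝ, (∀ i j, 0 ≤ r i j) → ∑ i, ∑ j, r i j ≤ 1 →
      ∀ i, ∑ j, r i j ∈ Set.Icc (0 : ℝ) 1 := fun r hr hr1 i =>
    ⟨Finset.sum_nonneg fun j _ => hr i j, le_trans (Finset.single_le_sum
      (f := fun i => ∑ j, r i j) (fun i _ => Finset.sum_nonneg fun j _ => hr i j)
      (Finset.mem_univ i)) hr1⟩
  have hcol : ∀ r : Fin k → Fin ℓ → ℝ, (∀ i j, 0 ≤ r i j) → ∑ i, ∑ j, r i j ≤ 1 →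
      ∀ j, ∑ i, r i j ∈ Set.Icc (0 : ℝ) 1 := fun r hr hr1 j =>
    ⟨Finset.sum_nonneg fun i _ => hr i j, le_trans (Finset.single_le_sum
      (f := fun j => ∑ i, r i j) (fun j _ => Finset.sum_nonneg fun i _ => hr i j)
      (Finset.mem_univ j)) (by rw [Finset.sum_comm]; exact hr1)⟩
  have hcell : ∀ r : Fin k → Fin ℓ → ℝ, (∀ i j, 0 ≤ r i j) → ∑ i, ∑ j, r i j ≤ 1 →
      ∀ x : Fin k × Fin ℓ, r x.1 x.2 ∈ Set.Icc (0 : ℝ) 1 := fun r hr hr1 x =>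
    ⟨hr _ _, (le_row_sum hr _ _).trans (hrow r hr hr1 x.1).2⟩
  have h1 := abs_sum_negMulLog_sub_le (T := T) (hrow p hp hp1) (hrow q hq hq1) hN
    ((Finset.sum_le_sum fun i _ => by
      rw [← Finset.sum_sub_distrib]; exact Finset.abs_sum_le_sum_abs _ _).trans hT)
  have h2 := abs_sum_negMulLog_sub_le (T := T) (hcol p hp hp1) (hcol q hq hq1) hN
    (((Finset.sum_le_sum fun j _ => by
      rw [← Finset.sum_sub_distrib]; exact Finset.abs_sum_le_sum_abs _ _).trans_eq
      Finset.sum_comm).trans hT)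
  have h3 := abs_sum_negMulLog_sub_le (T := T) (hcell p hp hp1) (hcell q hq hq1) hN
    (by rw [Fintype.sum_prod_type]; exact hT)
  rw [Fintype.sum_prod_type, Fintype.sum_prod_type] at h3
  simp only [Fintype.card_fin, Fintype.card_prod, Nat.cast_mul] at h1 h2 h3
  rw [mutualInfo_eq_entropy hp, mutualInfo_eq_entropy hq, ← sub_div, abs_div,
    abs_of_nonneg (Real.log_nonneg one_le_two)]
  refine div_le_div_of_nonneg_right ?_ (Real.log_nonneg one_le_two)
  rw [add_div, add_div]
  rw [abs_le] at h1 h2 h3 ⊢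
  constructor <;> linarith [h1.1, h1.2, h2.1, h2.2, h3.1, h3.2]

lemma abs_normMutualInfo_sub_le {k ℓ : ℕ} (hk : 2 ≤ k) (hℓ : 2 ≤ ℓ) {p q : Fin k → Fin ℓ → ℝ}
    (hp : ∀ i j, 0 ≤ p i j)
    (hq : ∀ i j, 0 ≤ q i j) (hp1 : ∑ i, ∑ j, p i j ≤ 1) (hq1 : ∑ i, ∑ j, q i j ≤ 1) {N T : ℝ}
    (hN : 1 ≤ N) (hT : ∑ i, ∑ j, |p i j - q i j| ≤ T) :
    |normMutualInfo p - normMutualInfo q| ≤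
      (3 * T * (1 + Real.log N) + (k + ℓ + k * ℓ) / N) / Real.log 2 := by
  have h := one_le_logb_min hk hℓ
  unfold normMutualInfo
  rw [← sub_div, abs_div, abs_of_nonneg (zero_le_one.trans h)]
  exact (div_le_self (abs_nonneg _) h).trans (abs_mutualInfo_sub_le hp hq hp1 hq1 hN hT)

/-! ### Interval partitions -/

lemma IsIntervalPartition.pairwise_disjoint {S : Set ℝ} {k : ℕ} {P : Fin k → Set ℝ}
    (h : IsIntervalPartition S P) : Pairwise fun i j => Disjoint (P i) (P j) := by
  intro i j hij
  rw [Set.disjoint_left]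
  intro y hi hj
  rcases lt_or_gt_of_ne hij with hlt | hlt
  · exact lt_irrefl _ (h.2.1 i j hlt y hi y hj)
  · exact lt_irrefl _ (h.2.1 j i hlt y hj y hi)

lemma IsIntervalPartition.measurableSet {S : Set ℝ} {k : ℕ} {P : Fin k → Set ℝ}
    (h : IsIntervalPartition S P) (i : Fin k) : MeasurableSet (P i) :=
  (h.1 i).2.measurableSet

/-- A partition of `[a, b]` into intervals extends to a partition of the real line. -/
lemma IsIntervalPartition.exists_extension {a b : ℝ} (hab : a ≤ b) {k : ℕ} {P : Fin k → Set ℝ}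
    (h : IsIntervalPartition (Set.Icc a b) P) :
    ∃ P' : Fin k → Set ℝ, IsIntervalPartition Set.univ P' ∧
      ∀ i, ∀ y ∈ Set.Icc a b, y ∈ P' i ↔ y ∈ P i := by
  -- Pulling back along the monotone retraction onto [a, b] lets the end parts absorb the two
  -- half-lines.
  set clamp : ℝ → ℝ := fun y => max a (min b y) with hclamp
  have hmono : Monotone clamp := fun y z hyz => max_le_max le_rfl (min_le_min le_rfl hyz)
  have hid : ∀ y ∈ Set.Icc a b, clamp y = y := fun y hy => by
    simp only [hclamp, min_eq_right hy.2, max_eq_right hy.1]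
  have hmem : ∀ y, clamp y ∈ Set.Icc a b := fun y =>
    ⟨le_max_left _ _, max_le hab (min_le_left _ _)⟩
  refine ⟨fun i => clamp ⁻¹' P i, ⟨fun i => ⟨?_, (h.1 i).2.preimage_mono hmono⟩, ?_, ?_⟩, ?_⟩
  · obtain ⟨y, hy⟩ := (h.1 i).1
    have hy' : y ∈ Set.Icc a b := h.2.2 ▸ Set.mem_iUnion_of_mem i hy
    exact ⟨y, by rw [Set.mem_preimage, hid y hy']; exact hy⟩
  · intro i j hij s hs t ht
    exact hmono.reflect_lt (h.2.1 i j hij _ hs _ ht)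
  · rw [← Set.preimage_iUnion, h.2.2]
    exact Set.eq_univ_of_forall hmem
  · intro i y hy
    rw [Set.mem_preimage, hid y hy]

/-! ### Range equipartitions -/

lemma mem_rangeEquipartition_bounds {a b : ℝ} {k : ℕ} {i : Fin k} {y : ℝ}
    (hy : y ∈ rangeEquipartition a b k i) :
    a + i * ((b - a) / k) ≤ y ∧ y ≤ a + ((i : ℝ) + 1) * ((b - a) / k) := by
  unfold rangeEquipartition at hy
  split_ifs at hy with h
  · refine ⟨hy.1, hy.2.trans_eq ?_⟩
    have hk : ((i : ℝ) + 1) = k := by exact_mod_cast h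
    have hk0 : (k : ℝ) ≠ 0 := by
      have := i.pos
      positivity
    rw [hk, mul_div_cancel₀ _ hk0]
    ring
  · exact ⟨hy.1, hy.2.le⟩

lemma rangeEquipartition_ordConnected (a b : ℝ) (k : ℕ) (i : Fin k) :
    (rangeEquipartition a b k i).OrdConnected := by
  unfold rangeEquipartition
  split_ifs
  · exact Set.ordConnected_Icc
  · exact Set.ordConnected_Ico

lemma rangeEquipartition_measurableSet (a b : ℝ) (k : ℕ) (i : Fin k) :
    MeasurableSet (rangeEquipartition a b k i) :=
  (rangeEquipartition_ordConnected a b k i).measurableSet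

lemma rangeEquipartition_lt {a b : ℝ} (hab : a ≤ b) {k : ℕ} {i j : Fin k} (hij : i < j) {s t : ℝ}
    (hs : s ∈ rangeEquipartition a b k i) (ht : t ∈ rangeEquipartition a b k j) : s < t := by
  have ht1 := (mem_rangeEquipartition_bounds ht).1
  -- Part i is not the last one, so it is open on the right; this gives the strict inequality.
  have hne : ¬ (i : ℕ) + 1 = k := by omega
  rw [rangeEquipartition, if_neg hne] at hs
  have hh : 0 ≤ (b - a) / k := div_nonneg (sub_nonneg.2 hab) (Nat.cast_nonneg k)
  have hij' : (i : ℝ) + 1 ≤ j := by exact_mod_cast hij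
  have := mul_le_mul_of_nonneg_right hij' hh
  linarith [hs.2]

lemma rangeEquipartition_iUnion {a b : ℝ} (hab : a ≤ b) {k : ℕ} (hk : 0 < k) :
    (⋃ i, rangeEquipartition a b k i) = Set.Icc a b := by
  have hk0 : (0 : ℝ) < k := by exact_mod_cast hk
  have hh : 0 ≤ (b - a) / k := div_nonneg (sub_nonneg.2 hab) hk0.le
  have hkh : (k : ℝ) * ((b - a) / k) = b - a := mul_div_cancel₀ _ hk0.ne'
  ext y
  rw [Set.mem_iUnion]
  constructor
  · rintro ⟨i, hi⟩
    have h := mem_rangeEquipartition_bounds hi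
    have hi1 : ((i : ℝ) + 1) ≤ k := by exact_mod_cast i.2
    have h1 := mul_le_mul_of_nonneg_right hi1 hh
    have h2 : 0 ≤ (i : ℝ) * ((b - a) / k) := by positivity
    exact ⟨by linarith [h.1], by linarith [h.2]⟩
  · intro hy
    classical
    -- The last part whose left endpoint is at most y. Unlike a quotient by the width, this also
    -- covers a = b.
    set m := Nat.findGreatest (fun i => a + (i : ℝ) * ((b - a) / k) ≤ y) (k - 1) with hm
    have hm1 : m ≤ k - 1 := Nat.findGreatest_le _
    have hmP : a + (m : ℝ) * ((b - a) / k) ≤ y :=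
      Nat.findGreatest_spec (P := fun i : ℕ => a + (i : ℝ) * ((b - a) / k) ≤ y) (Nat.zero_le _)
        (by simpa using hy.1)
    refine ⟨⟨m, by omega⟩, ?_⟩
    unfold rangeEquipartition
    split_ifs with h
    · exact ⟨hmP, hy.2⟩
    · refine ⟨hmP, ?_⟩
      have h2 := Nat.findGreatest_is_greatest (P := fun i : ℕ => a + (i : ℝ) * ((b - a) / k) ≤ y)
        (n := k - 1) (k := m + 1) (by omega) (by simp only at h; omega)
      push_cast at h2
      exact not_le.1 h2

lemma rangeEquipartition_nonempty {a b : ℝ} (hab : a < b) {k : ℕ} (i : Fin k) :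
    (rangeEquipartition a b k i).Nonempty := by
  have hk0 : (0 : ℝ) < k := by exact_mod_cast i.pos
  have hh : 0 < (b - a) / k := div_pos (sub_pos.2 hab) hk0
  have hkh : (k : ℝ) * ((b - a) / k) = b - a := mul_div_cancel₀ _ hk0.ne'
  have hi1 : ((i : ℝ) + 1) ≤ k := by exact_mod_cast i.2
  have h1 := mul_le_mul_of_nonneg_right hi1 hh.le
  refine ⟨a + (i : ℝ) * ((b - a) / k), ?_⟩
  unfold rangeEquipartition
  split_ifs
  · exact ⟨le_rfl, by linarith⟩
  · exact ⟨le_rfl, by linarith⟩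

lemma rangeEquipartition_isIntervalPartition {a b : ℝ} (hab : a < b) {k : ℕ} (hk : 0 < k) :
    IsIntervalPartition (Set.Icc a b) (rangeEquipartition a b k) :=
  ⟨fun i => ⟨rangeEquipartition_nonempty hab i, rangeEquipartition_ordConnected a b k i⟩,
    fun _ _ hij _ hs _ ht => rangeEquipartition_lt hab.le hij hs ht,
    rangeEquipartition_iUnion hab.le hk⟩

lemma rangeEquipartition_pairwise_disjoint {a b : ℝ} (hab : a ≤ b) (k : ℕ) :
    Pairwise fun i j => Disjoint (rangeEquipartition a b k i) (rangeEquipartition a b k j) := by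
  intro i j hij
  rw [Set.disjoint_left]
  intro y hi hj
  rcases lt_or_gt_of_ne hij with hlt | hlt
  · exact lt_irrefl _ (rangeEquipartition_lt hab hlt hi hj)
  · exact lt_irrefl _ (rangeEquipartition_lt hab hlt hj hi)

/-- The range equipartition of a point is concentrated in its last part. -/
lemma rangeEquipartition_self_eq_empty {a : ℝ} {k : ℕ} {i : Fin k} (hi : (i : ℕ) + 1 ≠ k) :
    rangeEquipartition a a k i = ∅ := by
  simp [rangeEquipartition, hi]

/-! ### Grids with measurable, disjoint cells -/

/-- Rows and columns are measurable and pairwise disjoint. -/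
structure Grid.IsRegular {k ℓ : ℕ} (G : Grid k ℓ) : Prop where
  rows_meas : ∀ i, MeasurableSet (G.rows i)
  cols_meas : ∀ j, MeasurableSet (G.cols j)
  rows_disj : Pairwise fun i j => Disjoint (G.rows i) (G.rows j)
  cols_disj : Pairwise fun i j => Disjoint (G.cols i) (G.cols j)

/-- The grid with the two axes exchanged. -/
def Grid.transpose {k ℓ : ℕ} (G : Grid k ℓ) : Grid ℓ k := ⟨G.cols, G.rows⟩

lemma Grid.IsRegular.transpose {k ℓ : ℕ} {G : Grid k ℓ} (h : G.IsRegular) :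
    G.transpose.IsRegular :=
  ⟨h.cols_meas, h.rows_meas, h.cols_disj, h.rows_disj⟩

lemma Grid.IsRegular.measurableSet_cell {k ℓ : ℕ} {G : Grid k ℓ} (h : G.IsRegular) (i : Fin k)
    (j : Fin ℓ) : MeasurableSet (G.cell i j) :=
  (measurable_fst (h.cols_meas j)).inter (measurable_snd (h.rows_meas i))

lemma isRegular_of_mem_allGrids {k ℓ : ℕ} {G : Grid k ℓ} (h : G ∈ allGrids k ℓ) : G.IsRegular :=
  ⟨h.1.measurableSet, h.2.measurableSet, h.1.pairwise_disjoint, h.2.pairwise_disjoint⟩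

lemma gridPMF_nonneg {k ℓ : ℕ} (law : Measure (ℝ × ℝ)) (G : Grid k ℓ) (i : Fin k) (j : Fin ℓ) :
    0 ≤ gridPMF law G i j := measureReal_nonneg

lemma Grid.IsRegular.sum_gridPMF {k ℓ : ℕ} {G : Grid k ℓ} (h : G.IsRegular)
    (law : Measure (ℝ × ℝ)) [IsFiniteMeasure law] (S : Finset (Fin k × Fin ℓ)) :
    ∑ x ∈ S, gridPMF law G x.1 x.2 = law.real (⋃ x ∈ S, G.cell x.1 x.2) := by
  refine (measureReal_biUnion_finset ?_ fun x _ => h.measurableSet_cell x.1 x.2).symm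
  intro x _ y _ hxy
  refine Set.disjoint_left.2 fun p hp hq => hxy (Prod.ext ?_ ?_)
  · by_contra hne
    exact Set.disjoint_left.1 (h.rows_disj hne) hp.2 hq.2
  · by_contra hne
    exact Set.disjoint_left.1 (h.cols_disj hne) hp.1 hq.1

lemma Grid.IsRegular.sum_gridPMF_le_one {k ℓ : ℕ} {G : Grid k ℓ} (h : G.IsRegular)
    (law : Measure (ℝ × ℝ)) [IsProbabilityMeasure law] :
    ∑ i, ∑ j, gridPMF law G i j ≤ 1 := by
  rw [← Fintype.sum_prod_type', h.sum_gridPMF]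
  exact measureReal_le_one

lemma Grid.IsRegular.sum_gridPMF_eq_one {k ℓ : ℕ} {G : Grid k ℓ} (h : G.IsRegular)
    (law : Measure (ℝ × ℝ)) [IsProbabilityMeasure law]
    (hG : ∀ᵐ p ∂law, p.1 ∈ ⋃ j, G.cols j ∧ p.2 ∈ ⋃ i, G.rows i) :
    ∑ i, ∑ j, gridPMF law G i j = 1 := by
  rw [← Fintype.sum_prod_type', h.sum_gridPMF, ← probReal_univ (μ := law)]
  refine measureReal_congr ?_
  filter_upwards [hG] with p hp
  refine propext ⟨fun _ => trivial, fun _ => ?_⟩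
  obtain ⟨j, hj⟩ := Set.mem_iUnion.1 hp.1
  obtain ⟨i, hi⟩ := Set.mem_iUnion.1 hp.2
  exact Set.mem_biUnion (Finset.mem_coe.2 (Finset.mem_univ (i, j))) ⟨hj, hi⟩

/-- Exchanging the axes of the law and of the grid together reduces statements about k > ℓ to k ≤ ℓ.
-/
lemma Grid.IsRegular.gridPMF_map_swap {k ℓ : ℕ} {G : Grid k ℓ} (h : G.IsRegular)
    (law : Measure (ℝ × ℝ)) (i : Fin k) (j : Fin ℓ) :
    gridPMF (law.map Prod.swap) G.transpose j i = gridPMF law G i j := by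
  unfold gridPMF
  rw [map_measureReal_apply measurable_swap (h.transpose.measurableSet_cell j i)]
  congr 1
  ext p
  exact and_comm

lemma Grid.IsRegular.normMutualInfo_map_swap {k ℓ : ℕ} {G : Grid k ℓ} (h : G.IsRegular)
    (law : Measure (ℝ × ℝ)) :
    normMutualInfo (gridPMF (law.map Prod.swap) G.transpose) = normMutualInfo (gridPMF law G) := by
  rw [← normMutualInfo_comm (gridPMF law G)]
  congr 1
  ext j i
  exact h.gridPMF_map_swap law i j

/-! ### Bounds on the characteristic matrix -/

section

variable (law : Measure (ℝ × ℝ)) [IsProbabilityMeasure law]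

lemma sum_gridPMF_of_mem_allGrids {k ℓ : ℕ} {G : Grid k ℓ} (hG : G ∈ allGrids k ℓ) :
    ∑ i, ∑ j, gridPMF law G i j = 1 := by
  refine (isRegular_of_mem_allGrids hG).sum_gridPMF_eq_one law (Eventually.of_forall fun p => ?_)
  rw [hG.1.2.2, hG.2.2.2]
  exact ⟨trivial, trivial⟩

lemma charEntry_le_one {k ℓ : ℕ} (hk : 2 ≤ k) (hℓ : 2 ≤ ℓ) : charEntry law k ℓ ≤ 1 := by
  refine Real.sSup_le ?_ zero_le_one
  rintro _ ⟨G, hG, rfl⟩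
  exact normMutualInfo_le_one hk hℓ (gridPMF_nonneg law G) (sum_gridPMF_of_mem_allGrids law hG)

lemma micStar_nonneg : 0 ≤ micStar law := by
  refine Real.sSup_nonneg ?_
  rintro _ ⟨k, ℓ, hk, hℓ, rfl⟩
  refine Real.sSup_nonneg ?_
  rintro _ ⟨G, hG, rfl⟩
  exact normMutualInfo_nonneg hk hℓ (gridPMF_nonneg law G) (sum_gridPMF_of_mem_allGrids law hG).le

/-- The bound by 1 matters for both suprema: `le_csSup` requires bounded sets of reals. -/
lemma normMutualInfo_le_micStar {k ℓ : ℕ} (hk : 2 ≤ k) (hℓ : 2 ≤ ℓ) {G : Grid k ℓ}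
    (hG : G ∈ allGrids k ℓ) : normMutualInfo (gridPMF law G) ≤ micStar law := by
  have h1 : normMutualInfo (gridPMF law G) ≤ charEntry law k ℓ := by
    refine le_csSup ⟨1, ?_⟩ ⟨G, hG, rfl⟩
    rintro _ ⟨G', hG', rfl⟩
    exact normMutualInfo_le_one hk hℓ (gridPMF_nonneg law G')
      (sum_gridPMF_of_mem_allGrids law hG')
  refine h1.trans (le_csSup ⟨1, ?_⟩ ⟨k, ℓ, hk, hℓ, rfl⟩)
  rintro _ ⟨m, n, hm, hn, rfl⟩
  exact charEntry_le_one law hm hn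

/-- Any grid on the support rectangle made of two interval partitions is dominated by `MIC*`. -/
lemma normMutualInfo_le_micStar_of_partition {x₀ x₁ y₀ y₁ : ℝ}
    (hL : ∀ᵐ p ∂law, p ∈ Set.Icc x₀ x₁ ×ˢ Set.Icc y₀ y₁) (hx : x₀ ≤ x₁) (hy : y₀ ≤ y₁) {k ℓ : ℕ}
    (hk : 2 ≤ k) (hℓ : 2 ≤ ℓ) {G : Grid k ℓ} (hr : IsIntervalPartition (Set.Icc y₀ y₁) G.rows)
    (hc : IsIntervalPartition (Set.Icc x₀ x₁) G.cols) :
    normMutualInfo (gridPMF law G) ≤ micStar law := by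
  obtain ⟨P, hP, hP'⟩ := hr.exists_extension hy
  obtain ⟨Q, hQ, hQ'⟩ := hc.exists_extension hx
  have : gridPMF law G = gridPMF law ⟨P, Q⟩ := by
    ext i j
    refine measureReal_congr ?_
    filter_upwards [hL] with p hp
    exact propext ⟨fun h => ⟨(hQ' j _ hp.1).2 h.1, (hP' i _ hp.2).2 h.2⟩,
      fun h => ⟨(hQ' j _ hp.1).1 h.1, (hP' i _ hp.2).1 h.2⟩⟩
  rw [this]
  exact normMutualInfo_le_micStar law hk hℓ ⟨hP, hQ⟩

end

lemma isRegular_of_mem_rangeGrids {x₀ x₁ y₀ y₁ c : ℝ} (hx : x₀ ≤ x₁) (hy : y₀ ≤ y₁) {k ℓ : ℕ}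
    {G : Grid k ℓ} (hG : G ∈ rangeGrids x₀ x₁ y₀ y₁ c k ℓ) : G.IsRegular := by
  unfold rangeGrids at hG
  rw [Set.mem_ofPred_eq] at hG
  split_ifs at hG with h
  · exact ⟨hG.2.1.measurableSet, by rw [hG.1]; exact rangeEquipartition_measurableSet _ _ _,
      hG.2.1.pairwise_disjoint, by rw [hG.1]; exact rangeEquipartition_pairwise_disjoint hx _⟩
  · exact ⟨by rw [hG.1]; exact rangeEquipartition_measurableSet _ _ _, hG.2.1.measurableSet,
      by rw [hG.1]; exact rangeEquipartition_pairwise_disjoint hy _, hG.2.1.pairwise_disjoint⟩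

/-- With a range equipartition of a point on the `x`-axis there is no mutual information. -/
lemma mutualInfo_eq_zero_of_cols_point (law : Measure (ℝ × ℝ)) [IsProbabilityMeasure law]
    {k ℓ : ℕ} (hℓ : 0 < ℓ) {G : Grid k ℓ} (hreg : G.IsRegular) {a : ℝ}
    (hcols : G.cols = rangeEquipartition a a ℓ)
    (hG : ∀ᵐ p ∂law, p.1 = a ∧ p.2 ∈ ⋃ i, G.rows i) : mutualInfo (gridPMF law G) = 0 := by
  refine mutualInfo_eq_zero_of_col (hreg.sum_gridPMF_eq_one law ?_) ⟨ℓ - 1, by omega⟩ ?_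
  · filter_upwards [hG] with p hp
    refine ⟨?_, hp.2⟩
    rw [hcols, rangeEquipartition_iUnion le_rfl hℓ, hp.1]
    exact ⟨le_rfl, le_rfl⟩
  · intro i j hj
    have hj' : (j : ℕ) + 1 ≠ ℓ := fun h => hj (Fin.ext (by simp only; omega))
    have : G.cell i j = ∅ := by
      ext p
      simp [Grid.cell, hcols, rangeEquipartition_self_eq_empty hj']
    simp [gridPMF, this]

/-- The population version of the range equicharacteristic matrix is dominated by `MIC*`. -/
lemma normMutualInfo_rangeGrids_le_micStar (law : Measure (ℝ × ℝ)) [IsProbabilityMeasure law]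
    {x₀ x₁ y₀ y₁ c : ℝ} (hL : ∀ᵐ p ∂law, p ∈ Set.Icc x₀ x₁ ×ˢ Set.Icc y₀ y₁) (hx : x₀ ≤ x₁)
    (hy : y₀ ≤ y₁) {k ℓ : ℕ} (hk : 2 ≤ k) (hℓ : 2 ≤ ℓ) {G : Grid k ℓ}
    (hG : G ∈ rangeGrids x₀ x₁ y₀ y₁ c k ℓ) :
    normMutualInfo (gridPMF law G) ≤ micStar law := by
  have hreg := isRegular_of_mem_rangeGrids hx hy hG
  unfold rangeGrids at hG
  rw [Set.mem_ofPred_eq] at hG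
  split_ifs at hG with h
  -- For x₀ = x₁ the range equipartition has empty parts and is no interval partition, so extension
  -- to the line is unavailable; the mutual information vanishes instead.
  · rcases hx.eq_or_lt with rfl | hlt
    · have : mutualInfo (gridPMF law G) = 0 := by
        refine mutualInfo_eq_zero_of_cols_point law (by omega) hreg hG.1 ?_
        filter_upwards [hL] with p hp
        rw [hG.2.1.2.2]
        exact ⟨le_antisymm hp.1.2 hp.1.1, hp.2⟩
      rw [normMutualInfo, this, zero_div]
      exact micStar_nonneg law
    · refine normMutualInfo_le_micStar_of_partition law hL hx hy hk hℓ hG.2.1 ?_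
      rw [hG.1]
      exact rangeEquipartition_isIntervalPartition hlt (by omega)
  · rcases hy.eq_or_lt with rfl | hlt
    · have hprob : IsProbabilityMeasure (law.map Prod.swap) :=
        Measure.isProbabilityMeasure_map measurable_swap.aemeasurable
      have : mutualInfo (gridPMF (law.map Prod.swap) G.transpose) = 0 := by
        refine mutualInfo_eq_zero_of_cols_point (law.map Prod.swap) (by omega) hreg.transpose
          hG.1 ?_
        refine ae_map_iff measurable_swap.aemeasurable ?_ |>.2 ?_
        · exact (measurable_fst (measurableSet_singleton _)).inter
            (measurable_snd (MeasurableSet.iUnion hreg.transpose.rows_meas))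
        · filter_upwards [hL] with p hp
          refine ⟨le_antisymm hp.2.2 hp.2.1, ?_⟩
          change p.1 ∈ ⋃ i, G.cols i
          rw [hG.2.1.2.2]
          exact hp.1
      rw [← hreg.normMutualInfo_map_swap law, normMutualInfo, this, zero_div]
      exact micStar_nonneg law
    · refine normMutualInfo_le_micStar_of_partition law hL hx hy hk hℓ ?_ hG.2.1
      rw [hG.1]
      exact rangeEquipartition_isIntervalPartition hlt (by omega)

/-! ### Approximation of interval partitions by range equipartitions -/

/-- Encoding a partition as a monotone labelling reduces its approximation to that of a step
function. -/
lemma IsIntervalPartition.exists_monotone {k : ℕ} {P : Fin k → Set ℝ}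
    (h : IsIntervalPartition Set.univ P) :
    ∃ f : ℝ → Fin k, Monotone f ∧ ∀ y i, y ∈ P i ↔ f y = i := by
  have hex : ∀ y, ∃ i, y ∈ P i := fun y => Set.mem_iUnion.1 (h.2.2 ▸ Set.mem_univ y)
  choose f hf using hex
  have huniq : ∀ y i, y ∈ P i ↔ f y = i := by
    refine fun y i => ⟨fun hi => ?_, fun hi => hi ▸ hf y⟩
    by_contra hne
    exact Set.disjoint_left.1 (h.pairwise_disjoint hne) (hf y) hi
  refine ⟨f, fun y z hyz => ?_, huniq⟩
  by_contra hlt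
  exact absurd (h.2.1 _ _ (not_le.1 hlt) z (hf z) y (hf y)) (not_lt.2 hyz)

/-- A monotone map with finitely many values has finitely many jumps. -/
lemma exists_finset_jumps {k : ℕ} {f : ℝ → Fin k} (hf : Monotone f) :
    ∃ J : Finset ℝ, ∀ y z, y ≤ z → f y ≠ f z → ∃ q ∈ J, y ≤ q ∧ q ≤ z := by
  classical
  -- The jump to label i. Only i = `f z` with `f y < f z` is used, where the set is nonempty and
  -- bounded; default values of `sSup` for other labels do no harm.
  refine ⟨Finset.univ.image fun i => sSup {y | f y < i}, fun y z hyz hne => ?_⟩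
  have hlt : f y < f z := lt_of_le_of_ne (hf hyz) hne
  have hub : z ∈ upperBounds {w | f w < f z} := fun w hw => (hf.reflect_lt hw).le
  exact ⟨_, Finset.mem_image_of_mem _ (Finset.mem_univ (f z)), le_csSup ⟨z, hub⟩ hlt,
    csSup_le ⟨y, hlt⟩ hub⟩

/-- A monotone map with finitely many values is the pointwise limit of maps that are constant on
the parts of range equipartitions. -/
lemma exists_monotone_approx {a b : ℝ} (hab : a < b) {k : ℕ} {f : ℝ → Fin k} (hf : Monotone f) :
    ∃ r : (j : ℕ) → Fin j → Fin k, (∀ j, Monotone (r j)) ∧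
      (∀ j t, ∃ y ∈ Set.Icc a b, f y = r j t) ∧
      ∀ y ∈ Set.Icc a b, ∀ᶠ j in atTop, ∀ t : Fin j, y ∈ rangeEquipartition a b j t →
        r j t = f y := by
  classical
  obtain ⟨J, hJ⟩ := exists_finset_jumps hf
  -- Each part is labelled at a sample point, taken to be a jump if the part contains one. Once the
  -- mesh separates y from the other jumps, a part containing y has constant label or its sample
  -- point is y itself. So labels converge at the jumps too, where the law may have atoms.
  have hs : ∀ j (t : Fin j), ∃ y ∈ rangeEquipartition a b j t,
      (∃ q ∈ J, q ∈ rangeEquipartition a b j t) → y ∈ J := by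
    intro j t
    by_cases h : ∃ q ∈ J, q ∈ rangeEquipartition a b j t
    · obtain ⟨q, hq, hqt⟩ := h
      exact ⟨q, hqt, fun _ => hq⟩
    · obtain ⟨y, hy⟩ := rangeEquipartition_nonempty hab t
      exact ⟨y, hy, fun h' => absurd h' h⟩
  choose s hs hsJ using hs
  refine ⟨fun j t => f (s j t), fun j t u htu => ?_, fun j t => ⟨s j t, ?_, rfl⟩,
    fun y hy => ?_⟩
  · rcases htu.eq_or_lt with rfl | hlt
    · exact le_rfl
    · exact hf (rangeEquipartition_lt hab.le hlt (hs j t) (hs j u)).le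
  · rw [← rangeEquipartition_iUnion hab.le t.pos]
    exact Set.mem_iUnion_of_mem t (hs j t)
  · have hlen : Tendsto (fun j : ℕ => (b - a) / (j : ℝ)) atTop (nhds 0) :=
      tendsto_const_div_atTop_nhds_zero_nat (b - a)
    have hJy : ∀ᶠ j : ℕ in atTop, ∀ q ∈ J, q ≠ y → (b - a) / (j : ℝ) < |q - y| := by
      rw [Filter.eventually_all_finset]
      intro q _
      by_cases hqy : q = y
      · exact Eventually.of_forall fun _ h => absurd hqy h
      · filter_upwards [hlen.eventually_lt_const (abs_pos.2 (sub_ne_zero.2 hqy))] with j hj _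
        exact hj
    filter_upwards [hJy] with j hj t hyt
    have hclose : ∀ q ∈ J, q ∈ rangeEquipartition a b j t → q = y := by
      intro q hq hqt
      by_contra hne
      have h1 := hj q hq hne
      have h2 := mem_rangeEquipartition_bounds hqt
      have h3 := mem_rangeEquipartition_bounds hyt
      refine absurd h1 (not_lt.2 (abs_le.2 ⟨?_, ?_⟩)) <;> linarith [h2.1, h2.2, h3.1, h3.2]
    by_contra hne
    have hord := (rangeEquipartition_ordConnected a b j t).out
    have hq : ∃ q ∈ J, q ∈ rangeEquipartition a b j t := by
      rcases le_total (s j t) y with hle | hle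
      · obtain ⟨q, hq, h1, h2⟩ := hJ _ _ hle hne
        exact ⟨q, hq, hord (hs j t) hyt ⟨h1, h2⟩⟩
      · obtain ⟨q, hq, h1, h2⟩ := hJ _ _ hle (Ne.symm hne)
        exact ⟨q, hq, hord hyt (hs j t) ⟨h1, h2⟩⟩
    exact hne (congrArg f (hclose _ (hsJ j t hq) (hs j t)))

/-- The partition obtained by merging the parts of a range equipartition that carry the same
label. -/
def mergedParts (a b : ℝ) {j k k' : ℕ} (r : Fin j → Fin k) (e : Fin k' → Fin k) (i : Fin k') :
    Set ℝ :=
  ⋃ t ∈ {t | r t = e i}, rangeEquipartition a b j t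

lemma mem_mergedParts {a b : ℝ} {j k k' : ℕ} {r : Fin j → Fin k} {e : Fin k' → Fin k} {i : Fin k'}
    {y : ℝ} : y ∈ mergedParts a b r e i ↔ ∃ t, r t = e i ∧ y ∈ rangeEquipartition a b j t := by
  simp [mergedParts]

lemma mergedParts_measurableSet (a b : ℝ) {j k k' : ℕ} (r : Fin j → Fin k) (e : Fin k' → Fin k)
    (i : Fin k') : MeasurableSet (mergedParts a b r e i) :=
  MeasurableSet.biUnion (Set.to_countable _) fun t _ => rangeEquipartition_measurableSet a b j t

lemma mergedParts_pairwise_disjoint {a b : ℝ} (hab : a ≤ b) {j k k' : ℕ} (r : Fin j → Fin k)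
    {e : Fin k' → Fin k} (he : Function.Injective e) :
    Pairwise fun i i' => Disjoint (mergedParts a b r e i) (mergedParts a b r e i') := by
  intro i i' hne
  rw [Set.disjoint_left]
  intro y hy hy'
  obtain ⟨t, ht, hyt⟩ := mem_mergedParts.1 hy
  obtain ⟨t', ht', hyt'⟩ := mem_mergedParts.1 hy'
  have : t = t' := by
    by_contra h
    exact Set.disjoint_left.1 (rangeEquipartition_pairwise_disjoint hab j h) hyt hyt'
  subst this
  exact hne (he (ht.symm.trans ht'))

/-- `e` lists in increasing order exactly the labels that occur: each is attained, so parts are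
nonempty, and none is missed, so they cover [a, b]. -/
lemma mergedParts_mem_rangeSubpartitions {a b : ℝ} (hab : a < b) {j k k' : ℕ} (hj : 0 < j)
    {r : Fin j → Fin k} (hr : Monotone r) (e : Fin k' ↪o Fin k) (h : Set.range r = Set.range e) :
    mergedParts a b r e ∈ rangeSubpartitions a b k' j := by
  have hrefl : ∀ {t u : Fin j} {y z : ℝ}, y ∈ rangeEquipartition a b j t →
      z ∈ rangeEquipartition a b j u → y ≤ z → t ≤ u := by
    intro t u y z hy hz hyz
    by_contra hlt
    exact absurd (rangeEquipartition_lt hab.le (not_le.1 hlt) hz hy) (not_lt.2 hyz)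
  have hcover : ∀ y ∈ Set.Icc a b, ∃ t, y ∈ rangeEquipartition a b j t := fun y hy =>
    Set.mem_iUnion.1 ((rangeEquipartition_iUnion hab.le hj).symm ▸ hy)
  have hsub : ∀ t, rangeEquipartition a b j t ⊆ Set.Icc a b := fun t =>
    (Set.subset_iUnion _ t).trans (rangeEquipartition_iUnion hab.le hj).le
  have hconn : ∀ i, {t | r t = e i}.OrdConnected := fun i =>
    ⟨fun t ht u hu v hv => le_antisymm ((hr hv.2).trans hu.le) (ht.ge.trans (hr hv.1))⟩
  refine ⟨⟨fun i => ⟨?_, ⟨?_⟩⟩, ?_, ?_⟩, fun i => ⟨_, hconn i, rfl⟩⟩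
  · obtain ⟨t, ht⟩ : e i ∈ Set.range r := h ▸ Set.mem_range_self i
    obtain ⟨y, hy⟩ := rangeEquipartition_nonempty hab t
    exact ⟨y, mem_mergedParts.2 ⟨t, ht, hy⟩⟩
  · intro y hy z hz w hw
    obtain ⟨t, ht, hyt⟩ := mem_mergedParts.1 hy
    obtain ⟨u, hu, hzu⟩ := mem_mergedParts.1 hz
    obtain ⟨v, hwv⟩ := hcover w ⟨(hsub t hyt).1.trans hw.1, hw.2.trans (hsub u hzu).2⟩
    exact mem_mergedParts.2 ⟨v, (hconn i).out ht hu ⟨hrefl hyt hwv hw.1, hrefl hwv hzu hw.2⟩, hwv⟩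
  · intro i i' hii s hs u hu
    obtain ⟨t, ht, hst⟩ := mem_mergedParts.1 hs
    obtain ⟨t', ht', hut⟩ := mem_mergedParts.1 hu
    refine rangeEquipartition_lt hab.le (hr.reflect_lt ?_) hst hut
    rw [ht, ht']
    exact e.strictMono hii
  · rw [← rangeEquipartition_iUnion hab.le hj]
    ext y
    simp only [Set.mem_iUnion, mem_mergedParts]
    constructor
    · rintro ⟨i, t, _, hy⟩
      exact ⟨t, hy⟩
    · rintro ⟨t, hy⟩
      obtain ⟨i, hi⟩ : r t ∈ Set.range e := h ▸ Set.mem_range_self t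
      exact ⟨i, t, hi.symm, hy⟩

/-- Rows are approximated from a fine equipartition, while the columns become the equipartition
itself. Merging these columns by label gives mass functions that converge to those of G, and undoing
the merger only adds information. -/
lemma exists_rangeGrid_approx (law : Measure (ℝ × ℝ)) [IsProbabilityMeasure law]
    {x₀ x₁ y₀ y₁ c : ℝ} (hL : ∀ᵐ p ∂law, p ∈ Set.Icc x₀ x₁ ×ˢ Set.Icc y₀ y₁) (hx : x₀ < x₁)
    (hy : y₀ < y₁) (hc : 0 < c) {k ℓ : ℕ} (hkℓ : k ≤ ℓ) {G : Grid k ℓ} (hG : G ∈ allGrids k ℓ)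
    (hMI : 0 < mutualInfo (gridPMF law G)) {δ : ℝ} (hδ : 0 < δ) :
    ∃ k' m : ℕ, 2 ≤ k' ∧ k' < m ∧ ∃ G' : Grid k' m, G'.IsRegular ∧
      G'.cols = rangeEquipartition x₀ x₁ m ∧ G'.rows ∈ rangeSubpartitions y₀ y₁ k' ⌊c * m⌋₊ ∧
      normMutualInfo (gridPMF law G) - δ ≤ normMutualInfo (gridPMF law G') := by
  classical
  obtain ⟨row, hrow, hrowP⟩ := hG.1.exists_monotone
  obtain ⟨col, hcol, hcolP⟩ := hG.2.exists_monotone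
  obtain ⟨ry, hry, hryI, hrylim⟩ := exists_monotone_approx hy hrow
  obtain ⟨rx, hrx, -, hrxlim⟩ := exists_monotone_approx hx hcol
  -- Rows that miss [y₀, y₁] carry no mass and must be dropped, since parts of a subpartition are
  -- nonempty. The normalizer can only shrink.
  set S : Finset (Fin k) := Finset.univ.filter fun i => ∃ y ∈ Set.Icc y₀ y₁, row y = i with hS
  set k' := S.card with hk'
  let e : Fin k' ↪o Fin k := S.orderEmbOfFin rfl
  have hrange : Set.range e = S := Finset.range_orderEmbOfFin S rfl
  have hmemS : ∀ i, i ∈ Set.range e ↔ ∃ y ∈ Set.Icc y₀ y₁, row y = i := fun i => by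
    rw [hrange]
    simp [hS]
  have hfloor : Tendsto (fun m : ℕ => ⌊c * (m : ℝ)⌋₊) atTop atTop :=
    tendsto_nat_floor_atTop.comp (tendsto_natCast_atTop_atTop.const_mul_atTop hc)
  let H : (m : ℕ) → Grid k' m := fun m =>
    ⟨mergedParts y₀ y₁ (ry ⌊c * (m : ℝ)⌋₊) e, rangeEquipartition x₀ x₁ m⟩
  have hH : ∀ m, (H m).IsRegular := fun m =>
    ⟨mergedParts_measurableSet _ _ _ _, rangeEquipartition_measurableSet _ _ _,
      mergedParts_pairwise_disjoint hy.le _ e.injective,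
      rangeEquipartition_pairwise_disjoint hx.le _⟩
  let p' : Fin k' → Fin ℓ → ℝ := fun i b => gridPMF law G (e i) b
  let q : ℕ → Fin k' → Fin ℓ → ℝ := fun m i b => ∑ j with rx m j = b, gridPMF law (H m) i j
  have hp'0 : ∀ i, i ∉ Set.range e → ∀ b, gridPMF law G i b = 0 := by
    intro i hi b
    rw [gridPMF, measureReal_eq_zero_iff, measure_eq_zero_iff_ae_notMem]
    filter_upwards [hL] with p hp hpc
    exact hi ((hmemS i).2 ⟨p.2, hp.2, (hrowP _ _).1 hpc.2⟩)
  have hMIp' : mutualInfo p' = mutualInfo (gridPMF law G) :=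
    mutualInfo_comp_injective e.injective hp'0
  have hsum : ∑ i, ∑ b, p' i b = 1 := by
    rw [← sum_gridPMF_of_mem_allGrids law hG]
    exact Fintype.sum_of_injective e e.injective _ _ (fun i hi => by simp [hp'0 i hi]) fun _ => rfl
  -- Positive mutual information is at most log k', which excludes k' ≤ 1.
  have hk'2 : 2 ≤ k' := by
    by_contra hlt
    have h1 := mutualInfo_le_logb_rows (p := p') (fun i b => gridPMF_nonneg law G _ _) hsum
    have h2 : Real.logb 2 (k' : ℝ) ≤ 0 := by
      have : k' = 0 ∨ k' = 1 := by omega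
      rcases this with h | h <;> simp [h]
    linarith [hMIp']
  have hlim : ∀ i b, Tendsto (fun m => q m i b) atTop (nhds (p' i b)) := by
    intro i b
    have hq : ∀ m, q m i b = law.real {p | ∃ j, rx m j = b ∧ p ∈ (H m).cell i j} := by
      intro m
      have h1 := (hH m).sum_gridPMF law (({i} : Finset (Fin k')) ×ˢ Finset.univ.filter
        fun j => rx m j = b)
      rw [Finset.sum_product, Finset.sum_singleton] at h1
      refine h1.trans ?_
      congr 1
      ext p
      simp
    simp_rw [hq]
    refine (ENNReal.tendsto_toReal (measure_ne_top _ _)).comp ?_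
    -- At each point of the rectangle both labels are eventually exact, so the indicators converge
    -- without any continuity of the law.
    refine tendsto_measure_of_ae_tendsto_indicator_of_isFiniteMeasure atTop
      ((isRegular_of_mem_allGrids hG).measurableSet_cell (e i) b) (fun m => ?_) ?_
    · have : {p | ∃ j, rx m j = b ∧ p ∈ (H m).cell i j} =
          ⋃ j ∈ {j | rx m j = b}, (H m).cell i j := by
        ext p
        simp
      rw [this]
      exact MeasurableSet.biUnion (Set.to_countable _) fun j _ => (hH m).measurableSet_cell i j
    · filter_upwards [hL] with p hp
      filter_upwards [hrxlim p.1 hp.1, hfloor.eventually (hrylim p.2 hp.2), eventually_gt_atTop 0,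
        hfloor.eventually (eventually_gt_atTop 0)] with m h1 h2 h3 h4
      obtain ⟨j, hj⟩ := Set.mem_iUnion.1 ((rangeEquipartition_iUnion hx.le h3).symm ▸ hp.1)
      obtain ⟨t, ht⟩ := Set.mem_iUnion.1 ((rangeEquipartition_iUnion hy.le h4).symm ▸ hp.2)
      constructor
      · rintro ⟨j', hj', hcell⟩
        obtain ⟨t', ht', hpt'⟩ := mem_mergedParts.1 hcell.2
        exact ⟨(hcolP _ _).2 ((h1 j' hcell.1).symm.trans hj'),
          (hrowP _ _).2 ((h2 t' hpt').symm.trans ht')⟩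
      · intro hcell
        exact ⟨j, (h1 j hj).trans ((hcolP _ _).1 hcell.1), hj,
          mem_mergedParts.2 ⟨t, (h2 t ht).trans ((hrowP _ _).1 hcell.2), ht⟩⟩
  have hlimMI := tendsto_mutualInfo (u := atTop) (p := q) (q := p')
    (fun m i b => Finset.sum_nonneg fun j _ => gridPMF_nonneg law (H m) i j)
    (fun i b => gridPMF_nonneg law G _ _) hlim
  have hhit : ∀ᶠ m : ℕ in atTop, ∀ i, e i ∈ Set.range (ry ⌊c * (m : ℝ)⌋₊) := by
    rw [Filter.eventually_all]
    intro i
    obtain ⟨y, hyI, hyi⟩ := (hmemS (e i)).1 ⟨i, rfl⟩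
    filter_upwards [hfloor.eventually (hrylim y hyI), hfloor.eventually (eventually_gt_atTop 0)]
      with m h1 h2
    obtain ⟨t, ht⟩ := Set.mem_iUnion.1 ((rangeEquipartition_iUnion hy.le h2).symm ▸ hyI)
    exact ⟨t, (h1 t ht).trans hyi⟩
  obtain ⟨m, hm1, hm2, hm3, hm4⟩ := ((hlimMI.eventually_const_lt (sub_lt_self _ hδ)).and
    (hhit.and ((eventually_gt_atTop k').and
      (hfloor.eventually (eventually_gt_atTop 0))))).exists
  refine ⟨k', m, hk'2, hm3, H m, hH m, rfl,
    mergedParts_mem_rangeSubpartitions hy hm4 (hry _) e ?_, ?_⟩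
  · refine Set.Subset.antisymm ?_ ?_
    · rintro _ ⟨t, rfl⟩
      exact (hmemS _).2 (hryI _ t)
    · rintro _ ⟨i, rfl⟩
      exact hm2 i
  · have hmerge : mutualInfo (q m) ≤ mutualInfo (gridPMF law (H m)) :=
      mutualInfo_merge_le (gridPMF_nonneg law (H m)) (rx m)
    have hk'k : k' ≤ k := by simpa using Finset.card_le_univ S
    have hlog1 := one_le_logb_min hk'2 (hk'2.trans hm3.le)
    -- Here min k' m = k' ≤ k = min k ℓ, however large m is.
    have hlog2 : Real.logb 2 (min k' m : ℕ) ≤ Real.logb 2 (min k ℓ : ℕ) := by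
      refine Real.logb_le_logb_of_le one_lt_two ?_ ?_
      · have : 0 < min k' m := by omega
        exact_mod_cast this
      · have : min k' m ≤ min k ℓ := by omega
        exact_mod_cast this
    have hnn := mutualInfo_nonneg (gridPMF_nonneg law (H m)) ((hH m).sum_gridPMF_le_one law)
    have hlog0 : 0 < Real.logb 2 (min k' m : ℕ) := one_pos.trans_le hlog1
    have hlog3 := hlog1.trans hlog2
    unfold normMutualInfo
    calc mutualInfo (gridPMF law G) / Real.logb 2 (min k ℓ : ℕ) - δ
        ≤ (mutualInfo (gridPMF law G) - δ) / Real.logb 2 (min k ℓ : ℕ) := by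
          rw [sub_div]
          exact sub_le_sub_left (div_le_self hδ.le hlog3) _
      _ ≤ mutualInfo (gridPMF law (H m)) / Real.logb 2 (min k ℓ : ℕ) :=
          div_le_div_of_nonneg_right (by linarith) (by linarith)
      _ ≤ _ := div_le_div_of_nonneg_left hnn hlog0 hlog2

/-- Without variation along the `x`-axis there is no mutual information. -/
lemma mutualInfo_eq_zero_of_ae_fst_eq (law : Measure (ℝ × ℝ)) [IsProbabilityMeasure law]
    {a : ℝ} (ha : ∀ᵐ p ∂law, p.1 = a) {k ℓ : ℕ} {G : Grid k ℓ} (hG : G ∈ allGrids k ℓ) :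
    mutualInfo (gridPMF law G) = 0 := by
  obtain ⟨col, -, hcol⟩ := hG.2.exists_monotone
  refine mutualInfo_eq_zero_of_col (sum_gridPMF_of_mem_allGrids law hG) (col a) fun i j hj => ?_
  rw [gridPMF, measureReal_eq_zero_iff, measure_eq_zero_iff_ae_notMem]
  filter_upwards [ha] with p hp hpc
  exact hj ((hcol _ _).1 (hp ▸ hpc.1)).symm

lemma transpose_mem_allGrids {k ℓ : ℕ} {G : Grid k ℓ} (hG : G ∈ allGrids k ℓ) :
    G.transpose ∈ allGrids ℓ k := ⟨hG.2, hG.1⟩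

/-- Positive information forces both sides of the rectangle to be nondegenerate; the case ℓ ≤ k
follows by exchanging the axes. -/
lemma exists_rangeGrid_of_allGrids (law : Measure (ℝ × ℝ)) [IsProbabilityMeasure law]
    {x₀ x₁ y₀ y₁ c : ℝ} (hL : ∀ᵐ p ∂law, p ∈ Set.Icc x₀ x₁ ×ˢ Set.Icc y₀ y₁) (hx : x₀ ≤ x₁)
    (hy : y₀ ≤ y₁) (hc : 0 < c) {k ℓ : ℕ} {G : Grid k ℓ}
    (hG : G ∈ allGrids k ℓ) (hMI : 0 < normMutualInfo (gridPMF law G)) {δ : ℝ} (hδ : 0 < δ) :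
    ∃ k' ℓ' : ℕ, 2 ≤ k' ∧ 2 ≤ ℓ' ∧ ∃ G' ∈ rangeGrids x₀ x₁ y₀ y₁ c k' ℓ',
      normMutualInfo (gridPMF law G) - δ ≤ normMutualInfo (gridPMF law G') := by
  have hprob : IsProbabilityMeasure (law.map Prod.swap) :=
    Measure.isProbabilityMeasure_map measurable_swap.aemeasurable
  have hL' : ∀ᵐ p ∂(law.map Prod.swap), p ∈ Set.Icc y₀ y₁ ×ˢ Set.Icc x₀ x₁ := by
    refine (ae_map_iff measurable_swap.aemeasurable
      (measurableSet_Icc.prod measurableSet_Icc)).2 ?_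
    filter_upwards [hL] with p hp using ⟨hp.2, hp.1⟩
  have hswap := (isRegular_of_mem_allGrids hG).normMutualInfo_map_swap law
  have hpos : ∀ {k ℓ : ℕ} {p : Fin k → Fin ℓ → ℝ}, 0 < normMutualInfo p → mutualInfo p ≠ 0 := by
    intro k ℓ p hp h0
    rw [normMutualInfo, h0, zero_div] at hp
    exact lt_irrefl _ hp
  have hx' : x₀ < x₁ := by
    refine hx.lt_of_ne ?_
    rintro rfl
    refine hpos hMI (mutualInfo_eq_zero_of_ae_fst_eq law (a := x₀) ?_ hG)
    filter_upwards [hL] with p hp using le_antisymm hp.1.2 hp.1.1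
  have hy' : y₀ < y₁ := by
    refine hy.lt_of_ne ?_
    rintro rfl
    refine hpos (hswap ▸ hMI) (mutualInfo_eq_zero_of_ae_fst_eq (law.map Prod.swap) (a := y₀) ?_
      (transpose_mem_allGrids hG))
    filter_upwards [hL'] with p hp using le_antisymm hp.1.2 hp.1.1
  have hMI' : ∀ {k ℓ : ℕ} {p : Fin k → Fin ℓ → ℝ}, 0 < normMutualInfo p → 0 < mutualInfo p := by
    intro k ℓ p hp
    by_contra h
    refine absurd hp (not_lt.2 (div_nonpos_of_nonpos_of_nonneg (not_lt.1 h) ?_))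
    exact div_nonneg (Real.log_natCast_nonneg _) (Real.log_nonneg one_le_two)
  rcases le_total k ℓ with hkℓ | hkℓ
  · obtain ⟨k', m, hk', hm, G', -, h1, h2, h3⟩ :=
      exists_rangeGrid_approx law hL hx' hy' hc hkℓ hG (hMI' hMI) hδ
    refine ⟨k', m, hk', by omega, G', ?_, h3⟩
    rw [rangeGrids, Set.mem_ofPred_eq, if_pos hm.le]
    exact ⟨h1, h2⟩
  · obtain ⟨k', m, hk', hm, G', hG', h1, h2, h3⟩ :=
      exists_rangeGrid_approx (law.map Prod.swap) hL' hy' hx' hc hkℓ (transpose_mem_allGrids hG)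
        (hMI' (hswap ▸ hMI)) hδ
    refine ⟨m, k', by omega, hk', G'.transpose, ?_, ?_⟩
    -- The strict inequality k' < m selects the branch with more rows than columns.
    · rw [rangeGrids, Set.mem_ofPred_eq, if_neg (not_le.2 hm)]
      exact ⟨h1, h2⟩
    · rw [hswap] at h3
      rw [← hG'.transpose.normMutualInfo_map_swap law]
      exact h3

/-- Population grids of range type come arbitrarily close to a positive `MIC*`. -/
lemma exists_rangeGrid_near_micStar (law : Measure (ℝ × ℝ)) [IsProbabilityMeasure law]
    {x₀ x₁ y₀ y₁ c : ℝ} (hL : ∀ᵐ p ∂law, p ∈ Set.Icc x₀ x₁ ×ˢ Set.Icc y₀ y₁) (hx : x₀ ≤ x₁)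
    (hy : y₀ ≤ y₁) (hc : 0 < c) {δ : ℝ} (hδ : 0 < δ) (hlt : δ < micStar law) :
    ∃ k ℓ : ℕ, 2 ≤ k ∧ 2 ≤ ℓ ∧ ∃ G ∈ rangeGrids x₀ x₁ y₀ y₁ c k ℓ,
      micStar law - δ ≤ normMutualInfo (gridPMF law G) := by
  have h1 : micStar law - δ / 2 < micStar law := by linarith
  have hentries : {v | ∃ k ℓ : ℕ, 2 ≤ k ∧ 2 ≤ ℓ ∧ v = charEntry law k ℓ}.Nonempty :=
    ⟨_, 2, 2, le_rfl, le_rfl, rfl⟩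
  obtain ⟨_, ⟨k, ℓ, hk, hℓ, rfl⟩, hv⟩ := exists_lt_of_lt_csSup hentries h1
  -- An empty set would have supremum 0, against δ < MIC*. The same hypothesis makes the value at
  -- the chosen grid positive.
  have hne : ((fun G : Grid k ℓ => normMutualInfo (gridPMF law G)) '' allGrids k ℓ).Nonempty := by
    by_contra hempty
    rw [charEntry, Set.not_nonempty_iff_eq_empty.1 hempty, Real.sSup_empty] at hv
    linarith
  obtain ⟨_, ⟨G, hG, rfl⟩, hv'⟩ := exists_lt_of_lt_csSup hne hv
  dsimp only at hv'
  obtain ⟨k', ℓ', hk', hℓ', G', hG', h2⟩ := exists_rangeGrid_of_allGrids law hL hx hy hc hG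
    (by linarith) (half_pos hδ)
  exact ⟨k', ℓ', hk', hℓ', G', hG', by linarith⟩

/-! ### Empirical measures -/

/-- The uniform distribution on the points of a dataset. -/
noncomputable def empirical {n : ℕ} (D : Fin n → ℝ × ℝ) : Measure (ℝ × ℝ) :=
  (n : ENNReal)⁻¹ • ∑ m, Measure.dirac (D m)

lemma isProbabilityMeasure_empirical {n : ℕ} (hn : 0 < n) (D : Fin n → ℝ × ℝ) :
    IsProbabilityMeasure (empirical D) := by
  refine ⟨?_⟩
  have h0 : (n : ENNReal) ≠ 0 := by exact_mod_cast hn.ne'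
  simp [empirical, ENNReal.inv_mul_cancel h0 (ENNReal.natCast_ne_top n)]

lemma empirical_real {n : ℕ} (D : Fin n → ℝ × ℝ) (A : Set (ℝ × ℝ)) :
    (empirical D).real A = (∑ m, A.indicator (fun _ => (1 : ℝ)) (D m)) / n := by
  classical
  have h : ∀ m, (Measure.dirac (D m)).real A = A.indicator (fun _ => (1 : ℝ)) (D m) := by
    intro m
    rw [Measure.real, Measure.dirac_apply]
    by_cases hm : D m ∈ A <;> simp [hm]
  have hsum : (∑ m, Measure.dirac (D m)).real A = ∑ m, (Measure.dirac (D m)).real A := by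
    rw [Measure.real, Measure.finsetSum_apply, ENNReal.toReal_sum fun m _ => measure_ne_top _ _]
    rfl
  rw [empirical, measureReal_ennreal_smul_apply, hsum]
  simp [h, div_eq_inv_mul]

/-- Treats a dataset as a law, so that the bounds on `gridPMF` apply to data. -/
lemma gridPMF_empirical {n k ℓ : ℕ} (D : Fin n → ℝ × ℝ) (G : Grid k ℓ) :
    gridPMF (empirical D) G = empiricalPMF D G := by
  classical
  ext i j
  rw [gridPMF, empirical_real, empiricalPMF]
  congr 1
  rw [Set.ncard_eq_toFinset_card']
  simp [Set.indicator_apply]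

section Hoeffding

variable {Ω : Type*} [MeasurableSpace Ω] {μ : Measure Ω} [IsProbabilityMeasure μ]
  {law : Measure (ℝ × ℝ)}

/-- Hoeffding's inequality for indicators, which are sub-Gaussian with variance proxy 1/4 after
centering; the negated variables give the other tail. -/
lemma measureReal_empirical_deviation_le {n : ℕ} (hn : 0 < n) {D : Fin n → Ω → ℝ × ℝ}
    (hindep : iIndepFun D μ) (hlaw : ∀ i, HasLaw (D i) law μ) {A : Set (ℝ × ℝ)}
    (hA : MeasurableSet A) {ε : ℝ} (hε : 0 ≤ ε) :
    μ.real {ω | ε ≤ |(empirical fun m => D m ω).real A - law.real A|} ≤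
      2 * Real.exp (-2 * n * ε ^ 2) := by
  have hn0 : (0 : ℝ) < n := by exact_mod_cast hn
  set f : ℝ × ℝ → ℝ := A.indicator fun _ => (1 : ℝ) with hf
  have hfm : Measurable f := measurable_const.indicator hA
  have hint : ∀ i, ∫ ω, f (D i ω) ∂μ = law.real A := by
    intro i
    rw [← integral_map (hlaw i).aemeasurable hfm.aestronglyMeasurable, (hlaw i).map_eq, hf,
      integral_indicator_const _ hA]
    simp
  have hsub : ∀ i, HasSubgaussianMGF (fun ω => f (D i ω) - law.real A) ((‖(1 : ℝ) - 0‖₊ / 2) ^ 2)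
      μ := by
    intro i
    rw [← hint i]
    refine hasSubgaussianMGF_of_mem_Icc (hfm.comp_aemeasurable (hlaw i).aemeasurable)
      (Eventually.of_forall fun ω => ?_)
    simp only [hf]
    by_cases h : D i ω ∈ A <;> simp [h]
  have hind : iIndepFun (fun i ω => f (D i ω) - law.real A) μ :=
    hindep.comp (fun _ z => f z - law.real A) fun _ => hfm.sub_const _
  have hind' : iIndepFun (fun i => -(fun ω => f (D i ω) - law.real A)) μ :=
    hindep.comp (fun _ z => -(f z - law.real A)) fun _ => (hfm.sub_const _).neg
  have h1 := HasSubgaussianMGF.measure_sum_ge_le_of_iIndepFun hind (s := Finset.univ)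
    (fun i _ => hsub i) (ε := n * ε) (by positivity)
  have h2 := HasSubgaussianMGF.measure_sum_ge_le_of_iIndepFun hind' (s := Finset.univ)
    (fun i _ => (hsub i).neg) (ε := n * ε) (by positivity)
  have hexp : -(n * ε) ^ 2 / (2 * ∑ _i : Fin n, (((‖(1 : ℝ) - 0‖₊ / 2) ^ 2 : NNReal) : ℝ)) =
      -2 * n * ε ^ 2 := by
    simp
    field_simp
  push_cast at h1 h2 hexp
  rw [hexp] at h1 h2
  rw [two_mul]
  refine le_trans (measureReal_mono ?_) ((measureReal_union_le _ _).trans (add_le_add h1 h2))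
  intro ω hω
  have hdev : (empirical fun m => D m ω).real A - law.real A =
      (∑ i, (f (D i ω) - law.real A)) / n := by
    rw [empirical_real, Finset.sum_sub_distrib]
    simp only [Finset.sum_const, Finset.card_univ, Fintype.card_fin, nsmul_eq_mul]
    field_simp
    rfl
  rw [Set.mem_ofPred_eq, hdev, abs_div, abs_of_pos hn0, le_div_iff₀ hn0, mul_comm, le_abs] at hω
  rcases hω with h | h
  · exact Or.inl h
  · refine Or.inr ?_
    simpa only [Set.mem_ofPred_eq, Pi.neg_apply, Finset.sum_neg_distrib] using h

lemma measureReal_exists_empirical_deviation_le {n : ℕ} (hn : 0 < n) {D : Fin n → Ω → ℝ × ℝ}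
    (hindep : iIndepFun D μ) (hlaw : ∀ i, HasLaw (D i) law μ) {ι : Type*} [Fintype ι]
    {A : ι → Set (ℝ × ℝ)} (hA : ∀ i, MeasurableSet (A i)) {ε : ℝ} (hε : 0 ≤ ε) :
    μ.real {ω | ∃ i, ε ≤ |(empirical fun m => D m ω).real (A i) - law.real (A i)|} ≤
      Fintype.card ι * (2 * Real.exp (-2 * n * ε ^ 2)) := by
  have : {ω | ∃ i, ε ≤ |(empirical fun m => D m ω).real (A i) - law.real (A i)|} =
      ⋃ i, {ω | ε ≤ |(empirical fun m => D m ω).real (A i) - law.real (A i)|} := by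
    ext ω
    simp
  rw [this]
  refine (measureReal_iUnion_fintype_le _).trans ?_
  refine (Finset.sum_le_sum fun i _ =>
    measureReal_empirical_deviation_le hn hindep hlaw (hA i) hε).trans ?_
  simp

end Hoeffding

/-! ### Uniform deviation over all range grids -/

/-- A union of cells of the product of two range equipartitions. -/
def cellUnion (x₀ x₁ y₀ y₁ : ℝ) (m j : ℕ) (T : Finset (Fin m × Fin j)) : Set (ℝ × ℝ) :=
  ⋃ t ∈ T, rangeEquipartition x₀ x₁ m t.1 ×ˢ rangeEquipartition y₀ y₁ j t.2

lemma cellUnion_measurableSet (x₀ x₁ y₀ y₁ : ℝ) (m j : ℕ) (T : Finset (Fin m × Fin j)) :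
    MeasurableSet (cellUnion x₀ x₁ y₀ y₁ m j T) :=
  Finset.measurableSet_biUnion _ fun t _ =>
    (rangeEquipartition_measurableSet x₀ x₁ m t.1).prod
      (rangeEquipartition_measurableSet y₀ y₁ j t.2)

lemma isSubpartition_self {k : ℕ} (C : Fin k → Set ℝ) : IsSubpartition C C :=
  fun i => ⟨{i}, Set.ordConnected_singleton, by simp⟩

lemma exists_cellUnion_eq {x₀ x₁ y₀ y₁ : ℝ} {k ℓ m j : ℕ} {G : Grid k ℓ}
    (hc : IsSubpartition G.cols (rangeEquipartition x₀ x₁ m))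
    (hr : IsSubpartition G.rows (rangeEquipartition y₀ y₁ j)) (S : Finset (Fin k × Fin ℓ)) :
    ∃ T, (⋃ x ∈ S, G.cell x.1 x.2) = cellUnion x₀ x₁ y₀ y₁ m j T := by
  classical
  choose u _ hu using hc
  choose s _ hs using hr
  refine ⟨Finset.univ.filter fun t => ∃ x ∈ S, t.1 ∈ u x.2 ∧ t.2 ∈ s x.1, ?_⟩
  ext p
  simp only [cellUnion, Set.mem_iUnion, Grid.cell, hu, hs, Finset.mem_filter, Finset.mem_univ,
    true_and, Set.mem_prod, Set.mem_ofPred_eq, exists_prop]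
  constructor
  · rintro ⟨x, hx, ⟨a, ha, hpa⟩, b, hb, hpb⟩
    exact ⟨(a, b), ⟨x, hx, ha, hb⟩, hpa, hpb⟩
  · rintro ⟨t, ⟨x, hx, ha, hb⟩, hpa, hpb⟩
    exact ⟨x, hx, ⟨t.1, ha, hpa⟩, t.2, hb, hpb⟩

/-- Labels for all unions of cells of the fine grids that underlie the range grids with at most
`N` rows and columns. -/
abbrev CellUnionIndex (c : ℝ) (N : ℕ) : Type :=
  Σ m : Fin (N + 1), Finset (Fin m × Fin ⌊c * (m : ℕ)⌋₊) ⊕ Finset (Fin ⌊c * (m : ℕ)⌋₊ × Fin m)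

/-- The set with a given label. -/
def indexedCellUnion (x₀ x₁ y₀ y₁ c : ℝ) (N : ℕ) (i : CellUnionIndex c N) : Set (ℝ × ℝ) :=
  Sum.elim (cellUnion x₀ x₁ y₀ y₁ i.1 ⌊c * (i.1 : ℕ)⌋₊)
    (cellUnion x₀ x₁ y₀ y₁ ⌊c * (i.1 : ℕ)⌋₊ i.1) i.2

lemma indexedCellUnion_measurableSet (x₀ x₁ y₀ y₁ c : ℝ) (N : ℕ) (i : CellUnionIndex c N) :
    MeasurableSet (indexedCellUnion x₀ x₁ y₀ y₁ c N i) := by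
  obtain ⟨m, T | T⟩ := i <;> exact cellUnion_measurableSet _ _ _ _ _ _ _

/-- Crude, but only the quadratic order of the exponent in N matters. -/
lemma card_cellUnionIndex_le {c : ℝ} (hc : 0 ≤ c) (N : ℕ) :
    Fintype.card (CellUnionIndex c N) ≤ 2 ^ (N + 1 + N * ⌊c * N⌋₊) := by
  rw [Fintype.card_sigma]
  have hterm : ∀ m : Fin (N + 1), Fintype.card (Finset (Fin m × Fin ⌊c * (m : ℕ)⌋₊) ⊕
      Finset (Fin ⌊c * (m : ℕ)⌋₊ × Fin m)) ≤ 2 * 2 ^ (N * ⌊c * N⌋₊) := by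
    intro m
    have hm : (m : ℕ) ≤ N := Nat.lt_succ_iff.1 m.2
    have h1 : ⌊c * (m : ℕ)⌋₊ ≤ ⌊c * N⌋₊ := by
      have : ((m : ℕ) : ℝ) ≤ N := by exact_mod_cast hm
      exact Nat.floor_mono (mul_le_mul_of_nonneg_left this hc)
    have h2 : 2 ^ ((m : ℕ) * ⌊c * (m : ℕ)⌋₊) ≤ 2 ^ (N * ⌊c * N⌋₊) :=
      Nat.pow_le_pow_right two_pos (Nat.mul_le_mul hm h1)
    simp only [Fintype.card_sum, Fintype.card_finset, Fintype.card_prod, Fintype.card_fin]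
    rw [mul_comm ⌊c * (m : ℕ)⌋₊]
    omega
  refine (Finset.sum_le_sum fun m _ => hterm m).trans ?_
  rw [Finset.sum_const, Finset.card_univ, Fintype.card_fin, smul_eq_mul, pow_add, pow_add]
  have : N + 1 ≤ 2 ^ N := Nat.lt_two_pow_self
  calc (N + 1) * (2 * 2 ^ (N * ⌊c * N⌋₊)) ≤ 2 ^ N * (2 * 2 ^ (N * ⌊c * N⌋₊)) :=
        Nat.mul_le_mul_right _ this
    _ = _ := by ring

/-- The index m is the larger of k and ℓ, and the summand records which axis carries the
equipartition. The finite family does not depend on the grid. -/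
lemma exists_indexedCellUnion_eq {x₀ x₁ y₀ y₁ c : ℝ} {k ℓ N : ℕ} (hk : k ≤ N) (hℓ : ℓ ≤ N)
    {G : Grid k ℓ} (hG : G ∈ rangeGrids x₀ x₁ y₀ y₁ c k ℓ) (S : Finset (Fin k × Fin ℓ)) :
    ∃ i, (⋃ x ∈ S, G.cell x.1 x.2) = indexedCellUnion x₀ x₁ y₀ y₁ c N i := by
  rw [rangeGrids, Set.mem_ofPred_eq] at hG
  split_ifs at hG with h
  · obtain ⟨T, hT⟩ := exists_cellUnion_eq (x₀ := x₀) (x₁ := x₁) (m := ℓ)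
      (by rw [hG.1]; exact isSubpartition_self _) hG.2.2 S
    exact ⟨⟨⟨ℓ, by omega⟩, Sum.inl T⟩, hT⟩
  · obtain ⟨T, hT⟩ := exists_cellUnion_eq (y₀ := y₀) (y₁ := y₁) (j := k) hG.2.2
      (by rw [hG.1]; exact isSubpartition_self _) S
    exact ⟨⟨⟨k, by omega⟩, Sum.inr T⟩, hT⟩

/-- Splitting by sign costs a factor 2, independent of the number of cells. -/
lemma sum_abs_le_two_mul {ι : Type*} [Fintype ι] {f : ι → ℝ} {ε : ℝ}
    (h : ∀ S : Finset ι, |∑ i ∈ S, f i| ≤ ε) : ∑ i, |f i| ≤ 2 * ε := by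
  classical
  rw [← Finset.sum_filter_add_sum_filter_not Finset.univ fun i => 0 ≤ f i, two_mul]
  refine add_le_add ?_ ?_
  · refine le_trans (le_of_eq ?_) ((le_abs_self _).trans (h (Finset.univ.filter fun i => 0 ≤ f i)))
    exact Finset.sum_congr rfl fun i hi => abs_of_nonneg (Finset.mem_filter.1 hi).2
  · refine le_trans (le_of_eq ?_) ((neg_le_abs _).trans
      (h (Finset.univ.filter fun i => ¬ 0 ≤ f i)))
    rw [← Finset.sum_neg_distrib]
    exact Finset.sum_congr rfl fun i hi => abs_of_neg (not_le.1 (Finset.mem_filter.1 hi).2)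

/-- The ℓ¹ distance is at most 2ε, whence 6ε; and k + ℓ + kℓ ≤ 2kℓ ≤ 2B because k, ℓ ≥ 2. -/
lemma abs_normMutualInfo_gridPMF_sub_le {x₀ x₁ y₀ y₁ c : ℝ} (hx : x₀ ≤ x₁) (hy : y₀ ≤ y₁)
    (ν law : Measure (ℝ × ℝ)) [IsProbabilityMeasure ν] [IsProbabilityMeasure law] {ε R B : ℝ}
    (hR : 1 ≤ R)
    (hdev : ∀ i, |ν.real (indexedCellUnion x₀ x₁ y₀ y₁ c ⌊B⌋₊ i) -
      law.real (indexedCellUnion x₀ x₁ y₀ y₁ c ⌊B⌋₊ i)| ≤ ε) {k ℓ : ℕ} (hk : 2 ≤ k) (hℓ : 2 ≤ ℓ)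
    (hkℓ : (k : ℝ) * ℓ ≤ B) {G : Grid k ℓ} (hG : G ∈ rangeGrids x₀ x₁ y₀ y₁ c k ℓ) :
    |normMutualInfo (gridPMF ν G) - normMutualInfo (gridPMF law G)| ≤
      (6 * ε * (1 + Real.log R) + 2 * B / R) / Real.log 2 := by
  have hreg := isRegular_of_mem_rangeGrids hx hy hG
  have hkℓN : k * ℓ ≤ ⌊B⌋₊ := Nat.le_floor (by exact_mod_cast hkℓ)
  have hkN : k ≤ ⌊B⌋₊ := le_trans (by nlinarith) hkℓN
  have hℓN : ℓ ≤ ⌊B⌋₊ := le_trans (by nlinarith) hkℓN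
  have hT : ∑ i, ∑ j, |gridPMF ν G i j - gridPMF law G i j| ≤ 2 * ε := by
    rw [← Fintype.sum_prod_type' (fun i j => |gridPMF ν G i j - gridPMF law G i j|)]
    refine sum_abs_le_two_mul fun S => ?_
    obtain ⟨i, hi⟩ := exists_indexedCellUnion_eq hkN hℓN hG S
    rw [Finset.sum_sub_distrib, hreg.sum_gridPMF, hreg.sum_gridPMF, hi]
    exact hdev i
  refine (abs_normMutualInfo_sub_le hk hℓ (gridPMF_nonneg ν G) (gridPMF_nonneg law G)
    (hreg.sum_gridPMF_le_one ν) (hreg.sum_gridPMF_le_one law) hR hT).trans ?_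
  refine div_le_div_of_nonneg_right ?_ (Real.log_nonneg one_le_two)
  refine add_le_add (le_of_eq (by ring)) (div_le_div_of_nonneg_right ?_ (by linarith))
  have hk' : (2 : ℝ) ≤ k := by exact_mod_cast hk
  have hℓ' : (2 : ℝ) ≤ ℓ := by exact_mod_cast hℓ
  nlinarith

/-! ### The statistic and its population value -/

lemma micr_le {n : ℕ} {D : Fin n → ℝ × ℝ} {x₀ x₁ y₀ y₁ B c v : ℝ} (hv : 0 ≤ v)
    (h : ∀ k ℓ : ℕ, 2 ≤ k → 2 ≤ ℓ → (k : ℝ) * ℓ ≤ B → ∀ G ∈ rangeGrids x₀ x₁ y₀ y₁ c k ℓ,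
      normMutualInfo (empiricalPMF D G) ≤ v) : micr D x₀ x₁ y₀ y₁ B c ≤ v := by
  refine Real.sSup_le ?_ hv
  rintro _ ⟨k, ℓ, hk, hℓ, hkℓ, rfl⟩
  refine Real.sSup_le ?_ hv
  rintro _ ⟨G, hG, rfl⟩
  exact h k ℓ hk hℓ hkℓ G hG

/-- The bound `v` serves only to make the nested suprema bounded; `0 ≤ v` covers entries without
grids, whose value is 0. -/
lemma le_micr {n : ℕ} {D : Fin n → ℝ × ℝ} {x₀ x₁ y₀ y₁ B c v : ℝ} (hv : 0 ≤ v)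
    (h : ∀ k ℓ : ℕ, 2 ≤ k → 2 ≤ ℓ → (k : ℝ) * ℓ ≤ B → ∀ G ∈ rangeGrids x₀ x₁ y₀ y₁ c k ℓ,
      normMutualInfo (empiricalPMF D G) ≤ v) {k ℓ : ℕ} (hk : 2 ≤ k) (hℓ : 2 ≤ ℓ)
    (hkℓ : (k : ℝ) * ℓ ≤ B) {G : Grid k ℓ} (hG : G ∈ rangeGrids x₀ x₁ y₀ y₁ c k ℓ) :
    normMutualInfo (empiricalPMF D G) ≤ micr D x₀ x₁ y₀ y₁ B c := by
  have h1 : normMutualInfo (empiricalPMF D G) ≤ rangeEntry D x₀ x₁ y₀ y₁ c k ℓ := by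
    refine le_csSup ⟨v, ?_⟩ ⟨G, hG, rfl⟩
    rintro _ ⟨G', hG', rfl⟩
    exact h k ℓ hk hℓ hkℓ G' hG'
  refine h1.trans (le_csSup ⟨v, ?_⟩ ⟨k, ℓ, hk, hℓ, hkℓ, rfl⟩)
  rintro _ ⟨k', ℓ', hk', hℓ', hkℓ', rfl⟩
  refine Real.sSup_le ?_ hv
  rintro _ ⟨G', hG', rfl⟩
  exact h k' ℓ' hk' hℓ' hkℓ' G' hG'

lemma micr_nonneg {n : ℕ} (hn : 0 < n) (D : Fin n → ℝ × ℝ) {x₀ x₁ y₀ y₁ : ℝ} (hx : x₀ ≤ x₁)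
    (hy : y₀ ≤ y₁) (B c : ℝ) : 0 ≤ micr D x₀ x₁ y₀ y₁ B c := by
  have hprob := isProbabilityMeasure_empirical hn D
  refine Real.sSup_nonneg ?_
  rintro _ ⟨k, ℓ, hk, hℓ, -, rfl⟩
  refine Real.sSup_nonneg ?_
  rintro _ ⟨G, hG, rfl⟩
  dsimp only
  rw [← gridPMF_empirical]
  exact normMutualInfo_nonneg hk hℓ (gridPMF_nonneg _ G)
    ((isRegular_of_mem_rangeGrids hx hy hG).sum_gridPMF_le_one _)

/-! ### Rates -/

lemma isLittleO_natCast_rpow {s t : ℝ} (hst : s < t) :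
    (fun n : ℕ => (n : ℝ) ^ s) =o[atTop] fun n : ℕ => (n : ℝ) ^ t := by
  have hpos : ∀ᶠ n : ℕ in atTop, (0 : ℝ) < n := by
    filter_upwards [eventually_gt_atTop 0] with n hn using by exact_mod_cast hn
  refine (Asymptotics.isLittleO_iff_tendsto' ?_).2 ?_
  · filter_upwards [hpos] with n hn h0 using absurd h0 (Real.rpow_pos_of_pos hn t).ne'
  · refine ((tendsto_rpow_neg_atTop (sub_pos.2 hst)).comp tendsto_natCast_atTop_atTop).congr' ?_
    filter_upwards [hpos] with n hn
    rw [Function.comp_apply, neg_sub, Real.rpow_sub hn]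

lemma tendsto_deviation_bound {α : ℝ} (hα : α ∈ Set.Ioo (0 : ℝ) (1 / 2)) {B : ℕ → ℝ}
    (hBα : B =O[atTop] fun n : ℕ => (n : ℝ) ^ α) {γ : ℝ} (hγ : 0 < γ) :
    Tendsto (fun n : ℕ => (6 * (n : ℝ) ^ (-γ) * (1 + Real.log n) + 2 * B n / n) / Real.log 2) atTop
      (nhds 0) := by
  have h1 : Tendsto (fun n : ℕ => (n : ℝ) ^ (-γ)) atTop (nhds 0) :=
    (tendsto_rpow_neg_atTop hγ).comp tendsto_natCast_atTop_atTop
  have h2 : Tendsto (fun n : ℕ => (n : ℝ) ^ (-γ) * Real.log n) atTop (nhds 0) := by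
    have h := ((isLittleO_log_rpow_atTop hγ).tendsto_div_nhds_zero).comp
      (tendsto_natCast_atTop_atTop (R := ℝ))
    refine h.congr fun n => ?_
    simp only [Function.comp_apply]
    rw [Real.rpow_neg (Nat.cast_nonneg n), div_eq_inv_mul]
  have h3 : Tendsto (fun n : ℕ => B n / n) atTop (nhds 0) := by
    have hlo : (fun n : ℕ => (n : ℝ) ^ α) =o[atTop] fun n : ℕ => (n : ℝ) ^ (1 : ℝ) :=
      isLittleO_natCast_rpow (by linarith [hα.2])
    refine (hBα.trans_isLittleO hlo).tendsto_div_nhds_zero.congr fun n => ?_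
    rw [Real.rpow_one]
  have h := (((h1.add h2).const_mul 6).add (h3.const_mul 2)).div_const (Real.log 2)
  simp only [add_zero, mul_zero, zero_div] at h
  refine h.congr fun n => ?_
  ring

/-- The logarithm of the cardinality is O(B²) = O(n^(2α)) = o(n^β), so half of the exponent -2n^β
absorbs it. -/
lemma tendsto_card_mul_exp {c : ℝ} (hc : 0 < c) {α β : ℝ} (hα : 0 < α) (hαβ : 2 * α < β)
    {B : ℕ → ℝ} (hB : Tendsto B atTop atTop) (hBα : B =O[atTop] fun n : ℕ => (n : ℝ) ^ α) :
    Tendsto (fun n : ℕ => (Fintype.card (CellUnionIndex c ⌊B n⌋₊) : ℝ) *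
      (2 * Real.exp (-2 * (n : ℝ) ^ β))) atTop (nhds 0) := by
  have hsq : (fun n => B n * B n) =O[atTop] fun n : ℕ => (n : ℝ) ^ (2 * α) := by
    refine (hBα.mul hBα).congr_right fun n => ?_
    rw [two_mul, Real.rpow_add_of_nonneg (Nat.cast_nonneg n) hα.le hα.le]
  have hconst : (fun _ : ℕ => (2 : ℝ)) =o[atTop] fun n : ℕ => (n : ℝ) ^ β := by
    refine (isLittleO_natCast_rpow (s := 0) (by linarith)).const_mul_left 2 |>.congr_left fun n => ?_
    simp
  have hlo : (fun n => 2 + B n + c * (B n * B n)) =o[atTop] fun n : ℕ => (n : ℝ) ^ β :=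
    (hconst.add (hBα.trans_isLittleO (isLittleO_natCast_rpow (by linarith)))).add
      ((hsq.trans_isLittleO (isLittleO_natCast_rpow hαβ)).const_mul_left c)
  have hexp : Tendsto (fun n : ℕ => Real.exp (-(n : ℝ) ^ β)) atTop (nhds 0) :=
    Real.tendsto_exp_neg_atTop_nhds_zero.comp
      ((tendsto_rpow_atTop (by linarith)).comp tendsto_natCast_atTop_atTop)
  refine squeeze_zero' (Eventually.of_forall fun n => by positivity) ?_ hexp
  filter_upwards [hlo.bound one_pos, hB.eventually_ge_atTop 0] with n h1 h2
  rw [one_mul, Real.norm_of_nonneg (by positivity), Real.norm_of_nonneg (by positivity)] at h1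
  set N := ⌊B n⌋₊
  have hN : (N : ℝ) ≤ B n := Nat.floor_le h2
  have hcN : (⌊c * (N : ℝ)⌋₊ : ℝ) ≤ c * B n :=
    (Nat.floor_le (by positivity)).trans (mul_le_mul_of_nonneg_left hN hc.le)
  have hcard : (Fintype.card (CellUnionIndex c N) : ℝ) ≤ 2 ^ (N + 1 + N * ⌊c * (N : ℝ)⌋₊) := by
    exact_mod_cast card_cellUnionIndex_le hc.le N
  have h2e : (2 : ℝ) ≤ Real.exp 1 := by linarith [Real.add_one_le_exp 1]
  calc (Fintype.card (CellUnionIndex c N) : ℝ) * (2 * Real.exp (-2 * (n : ℝ) ^ β))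
      ≤ 2 ^ (N + 1 + N * ⌊c * (N : ℝ)⌋₊) * (2 * Real.exp (-2 * (n : ℝ) ^ β)) :=
        mul_le_mul_of_nonneg_right hcard (by positivity)
    _ = 2 ^ (N + 1 + N * ⌊c * (N : ℝ)⌋₊ + 1) * Real.exp (-2 * (n : ℝ) ^ β) := by ring
    _ ≤ Real.exp 1 ^ (N + 1 + N * ⌊c * (N : ℝ)⌋₊ + 1) * Real.exp (-2 * (n : ℝ) ^ β) := by
        gcongr
    _ = Real.exp (2 + N + N * ⌊c * (N : ℝ)⌋₊ + -2 * (n : ℝ) ^ β) := by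
        rw [← Real.exp_nat_mul, ← Real.exp_add]
        push_cast
        ring_nf
    _ ≤ Real.exp (-(n : ℝ) ^ β) := by
        refine Real.exp_le_exp.2 ?_
        have : (N : ℝ) * ⌊c * (N : ℝ)⌋₊ ≤ B n * (c * B n) :=
          mul_le_mul hN hcN (Nat.cast_nonneg _) h2
        linarith

end MIC

/-! ### Convergence in probability -/

theorem mainTheorem2
    {Ω : Type*} [MeasurableSpace Ω] (μ : Measure Ω) [IsProbabilityMeasure μ]
    (law : Measure (ℝ × ℝ)) [IsProbabilityMeasure law]
    (x₀ x₁ y₀ y₁ : ℝ)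
    (hL : ∀ᵐ p ∂law, p ∈ Set.Icc x₀ x₁ ×ˢ Set.Icc y₀ y₁)
    (D : (n : ℕ) → Fin n → Ω → ℝ × ℝ)
    (hindep : ∀ n, iIndepFun (D n) μ)
    (hlaw : ∀ n i, HasLaw (D n i) law μ)
    (c : ℝ) (hc : 0 < c) (α : ℝ) (hα : α ∈ Set.Ioo (0 : ℝ) (1 / 2))
    (B : ℕ → ℝ) (hB : Tendsto B atTop atTop)
    (hBα : B =O[atTop] fun n : ℕ => (n : ℝ) ^ α) :
    TendstoInMeasure μ
      (fun n ω => MIC.micr (fun m => D n m ω) x₀ x₁ y₀ y₁ (B n) c)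
      atTop (fun _ => MIC.micStar law) := by
  obtain ⟨p, hp⟩ := hL.exists
  have hx : x₀ ≤ x₁ := hp.1.1.trans hp.1.2
  have hy : y₀ ≤ y₁ := hp.2.1.trans hp.2.2
  -- Chosen so that n · (n^(-γ))² = n^(1/2+α), which dominates n^(2α).
  set γ : ℝ := (1 / 2 - α) / 2 with hγ
  have hγ0 : 0 < γ := by linarith [hα.2]
  rw [tendstoInMeasure_iff_measureReal_dist]
  intro δ hδ
  set bad : ℕ → Set Ω := fun n => {ω | ∃ i, (n : ℝ) ^ (-γ) ≤
    |(MIC.empirical fun m => D n m ω).real (MIC.indexedCellUnion x₀ x₁ y₀ y₁ c ⌊B n⌋₊ i) -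
      law.real (MIC.indexedCellUnion x₀ x₁ y₀ y₁ c ⌊B n⌋₊ i)|} with hbad
  have hlim := MIC.tendsto_card_mul_exp hc (β := 1 / 2 + α) hα.1 (by linarith [hα.2]) hB hBα
  -- The near-optimal grid size is fixed before n and ω, so kℓ ≤ B(n) holds eventually.
  have hnear : ∃ k ℓ : ℕ, ∀ n ω, 0 < n → (k : ℝ) * ℓ ≤ B n → ∀ η, 0 ≤ η →
      (∀ k ℓ : ℕ, 2 ≤ k → 2 ≤ ℓ → (k : ℝ) * ℓ ≤ B n →
        ∀ G ∈ MIC.rangeGrids x₀ x₁ y₀ y₁ c k ℓ,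
        |MIC.normMutualInfo (MIC.empiricalPMF (fun m => D n m ω) G) -
          MIC.normMutualInfo (MIC.gridPMF law G)| ≤ η) →
      MIC.micStar law - δ / 2 - η ≤ MIC.micr (fun m => D n m ω) x₀ x₁ y₀ y₁ (B n) c := by
    by_cases hlt : δ / 2 < MIC.micStar law
    · obtain ⟨k, ℓ, hk, hℓ, G, hG, hGv⟩ :=
        MIC.exists_rangeGrid_near_micStar law hL hx hy hc (half_pos hδ) hlt
      refine ⟨k, ℓ, fun n ω _ hkℓ η hη hdev => ?_⟩
      have h1 := (abs_le.1 (hdev k ℓ hk hℓ hkℓ G hG)).1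
      have h2 : MIC.normMutualInfo (MIC.empiricalPMF (fun m => D n m ω) G) ≤
          MIC.micr (fun m => D n m ω) x₀ x₁ y₀ y₁ (B n) c := by
        refine MIC.le_micr (v := MIC.micStar law + η)
          (add_nonneg (MIC.micStar_nonneg law) hη) ?_ hk hℓ hkℓ hG
        intro k' ℓ' hk' hℓ' hkℓ' G' hG'
        have h3 := (abs_le.1 (hdev k' ℓ' hk' hℓ' hkℓ' G' hG')).2
        have h4 := MIC.normMutualInfo_rangeGrids_le_micStar law hL hx hy hk' hℓ' hG'
        linarith
      linarith
    -- If MIC* ≤ δ/2, nonnegativity of the statistic suffices and no grid is needed.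
    · refine ⟨0, 0, fun n ω hn _ η hη _ => ?_⟩
      have := MIC.micr_nonneg hn (fun m => D n m ω) hx hy (B n) c
      linarith [not_lt.1 hlt]
  obtain ⟨k, ℓ, hnear⟩ := hnear
  refine squeeze_zero' (Eventually.of_forall fun n => measureReal_nonneg) ?_ hlim
  filter_upwards [eventually_gt_atTop 0, hB.eventually_ge_atTop ((k : ℝ) * ℓ),
    (MIC.tendsto_deviation_bound hα hBα hγ0).eventually_lt_const (by linarith : 0 < δ / 2),
    hB.eventually_ge_atTop 0] with n hn hkℓ hη hB0
  have hn1 : (1 : ℝ) ≤ n := by exact_mod_cast hn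
  have hsub : {ω | δ ≤ dist (MIC.micr (fun m => D n m ω) x₀ x₁ y₀ y₁ (B n) c)
      (MIC.micStar law)} ⊆ bad n := by
    intro ω hω
    by_contra hgood
    simp only [hbad, Set.mem_ofPred_eq, not_exists, not_le] at hgood
    have hprob := MIC.isProbabilityMeasure_empirical hn (fun m => D n m ω)
    have hlog := Real.log_nonneg hn1
    have hη0 : 0 ≤ (6 * (n : ℝ) ^ (-γ) * (1 + Real.log n) + 2 * B n / n) / Real.log 2 := by
      have := Real.log_pos one_lt_two
      positivity
    have hdev : ∀ k ℓ : ℕ, 2 ≤ k → 2 ≤ ℓ → (k : ℝ) * ℓ ≤ B n →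
        ∀ G ∈ MIC.rangeGrids x₀ x₁ y₀ y₁ c k ℓ,
        |MIC.normMutualInfo (MIC.empiricalPMF (fun m => D n m ω) G) -
          MIC.normMutualInfo (MIC.gridPMF law G)| ≤
        (6 * (n : ℝ) ^ (-γ) * (1 + Real.log n) + 2 * B n / n) / Real.log 2 := by
      intro k ℓ hk hℓ hkℓ G hG
      rw [← MIC.gridPMF_empirical]
      exact MIC.abs_normMutualInfo_gridPMF_sub_le hx hy _ law hn1 (fun i => (hgood i).le) hk hℓ
        hkℓ hG
    have hlow := hnear n ω hn hkℓ _ hη0 hdev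
    have hup : MIC.micr (fun m => D n m ω) x₀ x₁ y₀ y₁ (B n) c ≤ MIC.micStar law +
        (6 * (n : ℝ) ^ (-γ) * (1 + Real.log n) + 2 * B n / n) / Real.log 2 := by
      refine MIC.micr_le (add_nonneg (MIC.micStar_nonneg law) hη0) ?_
      intro k' ℓ' hk' hℓ' hkℓ' G' hG'
      have h3 := (abs_le.1 (hdev k' ℓ' hk' hℓ' hkℓ' G' hG')).2
      have h4 := MIC.normMutualInfo_rangeGrids_le_micStar law hL hx hy hk' hℓ' hG'
      linarith
    rw [Set.mem_ofPred_eq, Real.dist_eq, le_abs] at hω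
    rcases hω with h | h <;> linarith
  refine (measureReal_mono hsub).trans ?_
  refine (MIC.measureReal_exists_empirical_deviation_le hn (hindep n) (hlaw n)
    (MIC.indexedCellUnion_measurableSet x₀ x₁ y₀ y₁ c _) (by positivity)).trans_eq ?_
  have hpow : (n : ℝ) * ((n : ℝ) ^ (-γ)) ^ 2 = (n : ℝ) ^ (1 / 2 + α) := by
    have hn0 : (0 : ℝ) < n := by linarith
    rw [← Real.rpow_natCast, ← Real.rpow_mul hn0.le]
    nth_rewrite 1 [← Real.rpow_one (n : ℝ)]
    rw [← Real.rpow_add hn0]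
    congr 1
    rw [hγ]
    push_cast
    ring
  rw [mul_assoc (-2 : ℝ), hpow]
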